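/- **Notation.** For a finite multiset $\Lambda$ of $d$ non-negative reals let $\widetilde e_i(\Lambda)=e_i(\Lambda)/\binom di$ be its normalized elementary symmetric polynomials ($\widetilde e_0=1$), and put $R_i(\Lambda)=\widetilde e_i(\Lambda)/\widetilde e_{i-1}(\Lambda)$ for $1\le i\le d$, read as $0$ if $\widetilde e_{i-1}(\Lambda)=0$. For monic polynomials $p(x)=\sum_{i=0}^d(-1)^ip_ix^{d-i}$ and $q(x)=\sum_{i=0}^d(-1)^iq_ix^{d-i}$ of degree $d$ let $(p\boxtimes_d q)(x)=\sum_{i=0}^d(-1)^i\frac{p_iq_i}{\binom di}x^{d-i}$, and let $p^{\boxtimes_d n}$ be the $n$-th power for this operation. For a probability measure $\mu\ne\delta_0$ on $[0,\infty)$ let $\psi_\mu(z)=\int_0^\infty\frac{tz}{1-tz}\,\mu(dt)$ for $z<0$, which is an increasing bijection of $(-\infty,0)$ onto $(\mu(\{0\})-1,0)$, and let $S_\mu(z)=\frac{z+1}{z}\psi_\mu^{-1}(z)$ for $z\in(\mu(\{0\})-1,0)$ be its S-transform. The free multiplicative convolution $\mu\boxtimes\nu$ of probability measures on $[0,\infty)$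 is the probability measure on $[0,\infty)$ with $(\mu\boxtimes\nu)(\{0\})=m:=\max\{\mu(\{0\}),\nu(\{0\})\}$ and $S_{\mu\boxtimes\nu}=S_\mu S_\nu$ on $(m-1,0)$. For a probability measure $\mu$ on $[0,\infty)$ that is not a point mass, $\Phi(\mu)$ denotes the probability measure on $[0,\infty)$ with $$\Phi(\mu)(\{0\})=\mu(\{0\}),\qquad \Phi(\mu)\Big(\Big[0,\tfrac1{S_\mu(t-1)}\Big]\Big)=t\quad\text{for } t\in(\mu(\{0\}),1),$$ and $\Phi(\delta_c)=\delta_c$ for $c\ge0$. **Proposition.** For every $d\ge1$ let $p_d$ be a monic polynomial of degree $d$ all of whose roots are real and non-negative, let $\Lambda_d=\{\lambda_{1,d}\ge\dots\ge\lambda_{d,d}\}$ be the multiset of its roots, and put $$\mu_d=\frac1d\sum_{i=1}^d\delta_{\lambda_{i,d}},\qquad \nu_d=\frac1d\sum_{i=1}^d\delta_{R_i(\Lambda_d)}.$$ Assume that $\mu$ is a probability measure and $K\subset[0,\infty)$ a compact set such that $\mu$ and all $\mu_d$, $d\ge1$, are supported on $K$, and that $\mu_d\to\mu$ weakly as $d\to\infty$.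 Then the following hold. 1. The $R_i(\Lambda_d)$ are the limit roots of $p_d$: for all $1\le i\le d$, if $\lambda_{i,d}^{(n)}$ denotes the $i$-th largest root (with multiplicity) of $p_d^{\boxtimes_d n}$, then $\lim_{n\to\infty}\big(\lambda_{i,d}^{(n)}\big)^{1/n}=R_i(\Lambda_d)$. 2. $R_1(\Lambda_d)\to\int_0^\infty t\,\mu(dt)$ as $d\to\infty$. 3. If moreover $0\notin K$, then $R_d(\Lambda_d)\to\big(\int_0^\infty t^{-1}\,\mu(dt)\big)^{-1}$ as $d\to\infty$. Furthermore the measure $\Phi(\mu)$ exists and is unique, the push-forwards of $\mu^{\boxtimes n}$ under $x\mapsto x^{1/n}$ converge weakly to $\Phi(\mu)$ as $n\to\infty$ (for every sequence of measures that are the powers $\mu^{\boxtimes n}$ in the above sense), $\log$ is $\Phi(\mu)$-integrable, and $$\int_0^\infty \log t\;\nu_d(dt)\to\int_0^\infty\log t\;\Phi(\mu)(dt)\qquad(d\to\infty).$$ -/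

import Mathlib

open MeasureTheory Filter Topology Polynomial
open scoped ENNReal BoundedContinuousFunction

namespace FiniteFree

/-- The number `p_i` in the expansion `p(x) = ∑ (-1)^i p_i x^(d-i)` of a polynomial of degree `d`. -/
noncomputable def signedCoeff (d : ℕ) (p : ℝ[X]) (i : ℕ) : ℝ :=
  (-1) ^ i * p.coeff (d - i)

/-- The finite free multiplicative convolution
`(p ⊠_d q)(x) = ∑_{i=0}^d (-1)^i (p_i q_i / binom(d,i)) x^(d-i)`. -/
noncomputable def mulConv (d : ℕ) (p q : ℝ[X]) : ℝ[X] :=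
  ∑ i ∈ Finset.range (d + 1),
    C ((-1) ^ i * (signedCoeff d p i * signedCoeff d q i / (d.choose i : ℝ))) * X ^ (d - i)

/-- The `n`-th power `p^{⊠_d n}`; the `0`-th power is the unit `(x - 1)^d` of `⊠_d`. -/
noncomputable def mulConvPow (d : ℕ) (p : ℝ[X]) : ℕ → ℝ[X]
  | 0 => (X - 1) ^ d
  | n + 1 => mulConv d (mulConvPow d p n) p

/-- The `i`-th largest real root of `q` (`i = 1, 2, …`), counted with multiplicity. The default
value `0` is used only when `q` has fewer than `i` real roots. -/
noncomputable def nthRoot (q : ℝ[X]) (i : ℕ) : ℝ :=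
  (q.roots.sort (· ≥ ·)).getD (i - 1) 0

/-- The normalized elementary symmetric polynomial `e_i(Λ) / binom(d,i)`, `d` the size of `Λ`. -/
noncomputable def normEsymm (s : Multiset ℝ) (i : ℕ) : ℝ :=
  s.esymm i / (s.card.choose i : ℝ)

/-- `R_i(Λ) = ẽ_i(Λ) / ẽ_{i-1}(Λ)` for `i ≥ 1`. If `Λ` has `d` non-negative elements of which
`k` are zero, this is `0` for `d - k + 1 ≤ i ≤ d`. -/
noncomputable def limitRoot (s : Multiset ℝ) (i : ℕ) : ℝ :=
  normEsymm s i / normEsymm s (i - 1)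

/-- The uniform probability measure on a finite non-empty multiset of reals:
`(1/d) ∑ δ_{λ_i}`. -/
noncomputable def empirical (s : Multiset ℝ) : Measure ℝ :=
  (s.card : ℝ≥0∞)⁻¹ • (s.map fun x => Measure.dirac x).sum

/-- The multiset `R_1(Λ), …, R_d(Λ)`, where `d` is the size of `Λ`. -/
noncomputable def limitRoots (s : Multiset ℝ) : Multiset ℝ :=
  (Finset.Icc 1 s.card).val.map (limitRoot s)

/-- Weak convergence of a sequence of finite measures on the line. -/
def WeakConv (μs : ℕ → Measure ℝ) (μ : Measure ℝ) : Prop :=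
  ∀ f : ℝ →ᵇ ℝ, Tendsto (fun n => ∫ x, f x ∂(μs n)) atTop (𝓝 (∫ x, f x ∂μ))

/-- `ψ_μ(z) = ∫ tz / (1 - tz) μ(dt)` for a measure `μ` on `[0,∞)` and real `z < 0`. -/
noncomputable def psi (μ : Measure ℝ) (z : ℝ) : ℝ :=
  ∫ t, t * z / (1 - t * z) ∂μ

/-- The inverse of `ψ_μ : (-∞, 0) → (μ({0}) - 1, 0)`, which for a probability measure
`μ ≠ δ_0` on `[0,∞)` is a strictly increasing bijection. -/
noncomputable def psiInv (μ : Measure ℝ) (z : ℝ) : ℝ :=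
  Function.invFunOn (psi μ) (Set.Iio 0) z

/-- The S-transform `S_μ(z) = ((z + 1) / z) ψ_μ⁻¹(z)` for `z ∈ (μ({0}) - 1, 0)`. -/
noncomputable def sTransform (μ : Measure ℝ) (z : ℝ) : ℝ :=
  (z + 1) / z * psiInv μ z

/-- `ρ = μ ⊠ ν`, the free multiplicative convolution of probability measures on `[0,∞)`,
characterized by `S_ρ = S_μ S_ν` on the common interval of definition and by
`ρ({0}) = max (μ({0}), ν({0}))`. (If `μ` or `ν` is `δ_0`, this says `ρ = δ_0`.) -/
structure IsFreeMulConv (μ ν ρ : Measure ℝ) : Prop where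
  prob : IsProbabilityMeasure ρ
  nonneg : ρ (Set.Iio 0) = 0
  atom : ρ.real {0} = max (μ.real {0}) (ν.real {0})
  sTransform_mul : ∀ z ∈ Set.Ioo (max (μ.real {0}) (ν.real {0}) - 1) 0,
    sTransform ρ z = sTransform μ z * sTransform ν z

/-- `ρ n = μ^{⊠ n}` for all `n ≥ 1`. -/
def IsFreeMulPowers (μ : Measure ℝ) (ρ : ℕ → Measure ℝ) : Prop :=
  ρ 1 = μ ∧ ∀ n ≥ 1, IsFreeMulConv (ρ n) μ (ρ (n + 1))

/-- `Φ = Φ(μ)`, the limit law in the free multiplicative law of large numbers, through its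
characterization by the S-transform: `Φ(μ)` is the probability measure on `[0,∞)` with
`Φ(μ)({0}) = μ({0})` and `Φ(μ)([0, 1 / S_μ(t - 1)]) = t` for `μ({0}) < t < 1`. For a point mass
`μ = δ_c` the S-transform is constant, no measure satisfies the latter, and `Φ(δ_c) = δ_c`. -/
structure IsLimitLaw (μ Φ : Measure ℝ) : Prop where
  prob : IsProbabilityMeasure Φ
  nonneg : Φ (Set.Iio 0) = 0
  atom : Φ {0} = μ {0}
  dirac : ∀ c : ℝ, μ = Measure.dirac c → Φ = Measure.dirac c
  cdf : (∀ c : ℝ, μ ≠ Measure.dirac c) → ∀ t ∈ Set.Ioo (μ.real {0}) 1,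
    Φ.real (Set.Icc 0 (1 / sTransform μ (t - 1))) = t

end FiniteFree

/-! Finite part. Write `ẽ_i` for the normalized elementary symmetric polynomials of the roots. The
convolution `⊠_d` multiplies them, so `p^{⊠n}(r^n) = ∑ (-1)^i binom(d,i) (ẽ_i r^(d-i))^n`, and for
large `n` the sign at `r^n` is that of the largest `ẽ_i r^(d-i)`. Unless all roots coincide,
Newton's inequalities are strict (`newton_inequality_strict`), the positive ratios `R_i` strictly
decrease, and index `i` dominates for `R_{i+1} < r < R_i` (`normEsymm_mul_pow_lt`). The sign thus
changes across each positive `R_i`, which traps a zero of the power near `R_i^n`; together with the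
zero of the right order at the origin these exhaust the degree. Real-rootedness of the powers is a
consequence and not an input.

Since `R_1` is the arithmetic and `R_d` the harmonic mean of the roots, items 2 and 3 follow from
weak convergence on a compact interval.

Free part. Here `0 ∉ K`, so `μ` lives on some `[a,b]` with `a > 0`. The function `s ↦ ∫ 1/(1+sx) dμ`
decreases from 1 to 0; its inverse `quant μ` is `t ↦ -ψ_μ⁻¹(t-1)`. The number `1/S_μ(t-1)` is the
mean of `x` under `μ` reweighted by `1/(1+sx)` with `s = quant μ t`, so it lies in `[a,b]` and
increases with `t`. It is therefore a quantile function, and `Φ(μ)` is the law it defines. For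
`μ^{⊠n}` the S-transform is the `n`-th power, so at the scale `x^n` the kernel `1/(1+sx)`
degenerates into a step function; this gives the law of large numbers.

The logarithmic integrals need no convergence of `ν_d`. The product of the `R_i` telescopes to the
product of the roots, so `ν_d` and `μ_d` have equal log-integrals; so do `Φ(μ)` and `μ`
(`integral_log_limitLaw`). It remains to integrate `log`, continuous on `[a,b]`, along `μ_d → μ`. -/

namespace FiniteFree

/-! ### Elementary symmetric polynomials and their normalization -/

theorem esymm_zero_right (s : Multiset ℝ) : s.esymm 0 = 1 := by
  simp [Multiset.esymm]

theorem esymm_cons_succ (a : ℝ) (s : Multiset ℝ) (k : ℕ) :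
    (a ::ₘ s).esymm (k + 1) = s.esymm (k + 1) + a * s.esymm k := by
  simp [Multiset.esymm, Multiset.powersetCard_cons, Multiset.sum_map_mul_left]

theorem esymm_eq_zero_of_card_lt {s : Multiset ℝ} {k : ℕ} (h : s.card < k) : s.esymm k = 0 := by
  simp [Multiset.esymm, Multiset.powersetCard_eq_empty k h]

theorem esymm_card (s : Multiset ℝ) : s.esymm s.card = s.prod := by
  simp [Multiset.esymm]

theorem esymm_replicate (d : ℕ) (c : ℝ) (k : ℕ) :
    (Multiset.replicate d c).esymm k = d.choose k * c ^ k := by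
  induction d generalizing k with
  | zero => cases k <;> simp [Multiset.esymm, Multiset.powersetCard_zero_right]
  | succ d ih =>
    cases k with
    | zero => simp [esymm_zero_right]
    | succ k =>
      rw [Multiset.replicate_succ, esymm_cons_succ, ih, ih, Nat.choose_succ_succ]
      push_cast
      ring

theorem esymm_nonneg {s : Multiset ℝ} (hs : ∀ x ∈ s, 0 ≤ x) (k : ℕ) : 0 ≤ s.esymm k := by
  refine Multiset.sum_nonneg fun y hy => ?_
  obtain ⟨t, ht, rfl⟩ := Multiset.mem_map.1 hy
  exact Multiset.prod_nonneg fun x hx =>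
    hs x (Multiset.mem_of_le (Multiset.mem_powersetCard.1 ht).1 hx)

/-- A sum of non-negative products is positive exactly when one product is, that is, when `k` of the
elements are all positive. -/
theorem esymm_pos_iff {s : Multiset ℝ} (hs : ∀ x ∈ s, 0 ≤ x) (k : ℕ) :
    0 < s.esymm k ↔ k ≤ (s.filter (0 < ·)).card := by
  induction s using Multiset.induction_on generalizing k with
  | empty => cases k <;> simp [Multiset.esymm, Multiset.powersetCard_zero_right]
  | cons a s ih =>
    have hs' : ∀ x ∈ s, 0 ≤ x := fun x hx => hs x (Multiset.mem_cons_of_mem hx)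
    cases k with
    | zero => simp [esymm_zero_right]
    | succ k =>
      rw [esymm_cons_succ]
      rcases (hs a (Multiset.mem_cons_self a s)).eq_or_lt with h | h
      · rw [← h, Multiset.filter_cons_of_neg _ (lt_irrefl _), zero_mul, add_zero, ih hs']
      · rw [Multiset.filter_cons_of_pos _ h, Multiset.card_cons, Nat.succ_le_succ_iff, ← ih hs']
        constructor
        · intro hp
          by_contra h0
          have hk : s.esymm k = 0 := le_antisymm (not_lt.1 h0) (esymm_nonneg hs' k)
          rw [hk, mul_zero, add_zero, ih hs'] at hp
          exact h0 ((ih hs' k).2 (by omega))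
        · intro hp
          have := esymm_nonneg hs' (k + 1)
          positivity

theorem normEsymm_zero_right (s : Multiset ℝ) : normEsymm s 0 = 1 := by
  simp [normEsymm, esymm_zero_right]

theorem normEsymm_nonneg {s : Multiset ℝ} (hs : ∀ x ∈ s, 0 ≤ x) (k : ℕ) : 0 ≤ normEsymm s k :=
  div_nonneg (esymm_nonneg hs k) (Nat.cast_nonneg _)

theorem normEsymm_pos_iff {s : Multiset ℝ} (hs : ∀ x ∈ s, 0 ≤ x) (k : ℕ) :
    0 < normEsymm s k ↔ k ≤ (s.filter (0 < ·)).card := by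
  rw [← esymm_pos_iff hs, normEsymm]
  constructor
  · intro h
    by_contra h0
    rw [le_antisymm (not_lt.1 h0) (esymm_nonneg hs k), zero_div] at h
    exact lt_irrefl _ h
  · intro h
    have h1 := ((esymm_pos_iff hs k).1 h).trans (Multiset.card_le_card (Multiset.filter_le _ _))
    have := Nat.choose_pos h1
    positivity

theorem normEsymm_eq_zero_of_card_lt {s : Multiset ℝ} {k : ℕ} (h : s.card < k) :
    normEsymm s k = 0 := by
  rw [normEsymm, esymm_eq_zero_of_card_lt h, zero_div]

theorem choose_mul_normEsymm {s : Multiset ℝ} {k : ℕ} (h : k ≤ s.card) :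
    (s.card.choose k : ℝ) * normEsymm s k = s.esymm k :=
  mul_div_cancel₀ _ (Nat.cast_ne_zero.2 (Nat.choose_pos h).ne')

theorem normEsymm_replicate {d k : ℕ} (h : k ≤ d) (c : ℝ) :
    normEsymm (Multiset.replicate d c) k = c ^ k := by
  rw [normEsymm, esymm_replicate, Multiset.card_replicate, mul_div_cancel_left₀]
  exact Nat.cast_ne_zero.2 (Nat.choose_pos h).ne'

/-! ### Newton's inequalities and their equality case -/

theorem normEsymm_cons_succ (a : ℝ) (s : Multiset ℝ) {k : ℕ} (hk : k ≤ s.card) :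
    ((s.card : ℝ) + 1) * normEsymm (a ::ₘ s) (k + 1) =
      ((s.card : ℝ) - k) * normEsymm s (k + 1) + (k + 1) * a * normEsymm s k := by
  obtain ⟨m, hm⟩ : ∃ m, s.card = m := ⟨_, rfl⟩
  have hc : ((m + 1).choose (k + 1) : ℝ) ≠ 0 :=
    Nat.cast_ne_zero.2 (Nat.choose_pos (by omega)).ne'
  have h1 : ((m : ℝ) + 1) * m.choose k = (m + 1).choose (k + 1) * (k + 1) := by
    exact_mod_cast Nat.add_one_mul_choose_eq m k
  have h2 : (m.choose (k + 1) : ℝ) * (k + 1) = m.choose k * (m - k) := by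
    rw [← Nat.cast_sub (hm ▸ hk)]
    exact_mod_cast Nat.choose_succ_right_eq m k
  have h3 : ((m + 1).choose (k + 1) : ℝ) * (m - k) = (m + 1) * m.choose (k + 1) := by
    have h4 : ((m + 1).choose (k + 1) : ℝ) = m.choose k + m.choose (k + 1) := by
      exact_mod_cast Nat.choose_succ_succ m k
    rw [h4]
    linarith
  have e1 : (m.choose (k + 1) : ℝ) * normEsymm s (k + 1) = s.esymm (k + 1) := by
    rcases (hm ▸ hk : k ≤ m).eq_or_lt with h | h
    · rw [esymm_eq_zero_of_card_lt (by omega), normEsymm_eq_zero_of_card_lt (by omega), mul_zero]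
    · rw [← hm, choose_mul_normEsymm (by omega)]
  have e0 : (m.choose k : ℝ) * normEsymm s k = s.esymm k := by
    rw [← hm, choose_mul_normEsymm hk]
  rw [normEsymm, Multiset.card_cons, hm, esymm_cons_succ, ← e1, ← e0]
  field_simp
  linear_combination (-normEsymm s (k + 1)) * h3 + a * normEsymm s k * h1

/-- The quadratic form behind the induction step of Newton's inequalities. -/
theorem newton_step {x y z w a p q : ℝ} (hp : 1 ≤ p) (hq : 1 ≤ q) (ha : 0 ≤ a)
    (hxw : x * w ≤ y * z) :
    (z - a * y) ^ 2 + (p ^ 2 - 1) * (z ^ 2 - y * w)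
        + a ^ 2 * ((q ^ 2 - 1) * y ^ 2 - (q ^ 2 - 1) * (x * z)) ≤
      (p * z + q * a * y) ^ 2 -
        ((p + 1) * y + (q - 1) * a * x) * ((p - 1) * w + (q + 1) * a * z) := by
  -- The two sides differ by exactly `(p - 1) (q - 1) a (y z - x w)`.
  have h := mul_nonneg (mul_nonneg (mul_nonneg (sub_nonneg.2 hp) (sub_nonneg.2 hq)) ha)
    (sub_nonneg.2 hxw)
  nlinarith [h]

/-- Multiply the two log-concavity inequalities and cancel `y z`; the last two hypotheses settle the
case where it vanishes. This supplies the hypothesis `hxw` of `newton_step`. -/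
theorem outer_mul_le_of_logConcave {x y z w : ℝ} (hy : 0 ≤ y) (hz : 0 ≤ z)
    (hw : 0 ≤ w) (hxz : x * z ≤ y ^ 2) (hyw : y * w ≤ z ^ 2) (hy0 : y = 0 → w = 0)
    (hz0 : z = 0 → w = 0) : x * w ≤ y * z := by
  rcases hy.eq_or_lt with h | h
  · rw [hy0 h.symm, mul_zero]; positivity
  rcases hz.eq_or_lt with h' | h'
  · rw [hz0 h'.symm, mul_zero]; positivity
  have hmul : (x * z) * (y * w) ≤ y ^ 2 * z ^ 2 := by gcongr
  have : (x * w) * (y * z) ≤ (y * z) * (y * z) := by linarith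
  exact le_of_mul_le_mul_right this (by positivity)

theorem normEsymm_eq_zero_of_le {s : Multiset ℝ} (hs : ∀ x ∈ s, 0 ≤ x) {j k : ℕ} (hjk : j ≤ k)
    (h : normEsymm s j = 0) : normEsymm s k = 0 := by
  by_contra h0
  have h1 := (normEsymm_pos_iff hs k).1 (lt_of_le_of_ne (normEsymm_nonneg hs k) (Ne.symm h0))
  exact ((normEsymm_pos_iff hs j).2 (hjk.trans h1)).ne' h

/-- The lower bound for the Newton difference of `a ::ₘ s`, given Newton's inequalities for `s`. -/
theorem newton_difference_cons {s : Multiset ℝ} {a : ℝ} (ha : 0 ≤ a) (hs : ∀ x ∈ s, 0 ≤ x)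
    (hN : ∀ k, normEsymm s k * normEsymm s (k + 2) ≤ normEsymm s (k + 1) ^ 2)
    {k : ℕ} (hk : k + 1 ≤ s.card) :
    (normEsymm s (k + 1) - a * normEsymm s k) ^ 2
      + (((s.card : ℝ) - k) ^ 2 - 1) *
          (normEsymm s (k + 1) ^ 2 - normEsymm s k * normEsymm s (k + 2))
      + a ^ 2 * ((((k : ℝ) + 1) ^ 2 - 1) * normEsymm s k ^ 2 -
          (((k : ℝ) + 1) ^ 2 - 1) * (normEsymm s (k - 1) * normEsymm s (k + 1))) ≤
      ((s.card : ℝ) + 1) ^ 2 * (normEsymm (a ::ₘ s) (k + 1) ^ 2 -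
        normEsymm (a ::ₘ s) k * normEsymm (a ::ₘ s) (k + 2)) := by
  have hp : (1 : ℝ) ≤ (s.card : ℝ) - k := by
    have : ((k + 1 : ℕ) : ℝ) ≤ s.card := Nat.cast_le.2 hk
    push_cast at this
    linarith
  have r1 := normEsymm_cons_succ a s (k := k) (by omega)
  have r2 := normEsymm_cons_succ a s (k := k + 1) hk
  have hle : ∀ {i j}, i ≤ j → normEsymm s i = 0 → normEsymm s j = 0 := fun h =>
    normEsymm_eq_zero_of_le hs h
  have hnn := normEsymm_nonneg hs
  push_cast at r2
  rcases Nat.eq_zero_or_pos k with rfl | hk0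
  -- For `k = 0` there is no lower neighbour; with `q = 1` its coefficient `q - 1` is zero, so `x =
  -- 0` is a harmless choice.
  · have h := newton_step (x := 0) (y := normEsymm s 0) (z := normEsymm s 1)
      (w := normEsymm s 2) (q := 1) hp le_rfl ha
      (by have := hnn 0; have := hnn 1; simp only [zero_mul]; positivity)
    have e : ((s.card : ℝ) + 1) ^ 2 * (normEsymm (a ::ₘ s) (0 + 1) ^ 2 -
        normEsymm (a ::ₘ s) 0 * normEsymm (a ::ₘ s) (0 + 2)) =
        (((s.card : ℝ) + 1) * normEsymm (a ::ₘ s) (0 + 1)) ^ 2 - ((s.card : ℝ) + 1) *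
          (((s.card : ℝ) + 1) * normEsymm (a ::ₘ s) (0 + 1 + 1)) := by
      rw [normEsymm_zero_right]; ring
    rw [e, r1, r2]
    simp only [normEsymm_zero_right, Nat.cast_zero, zero_add] at h ⊢
    norm_num at h ⊢
    linarith
  · obtain ⟨j, rfl⟩ : ∃ j, k = j + 1 := ⟨k - 1, by omega⟩
    have r0 := normEsymm_cons_succ a s (k := j) (by omega)
    push_cast at r1 r2 hp ⊢
    have hq : (1 : ℝ) ≤ (j : ℝ) + 1 + 1 := by
      have := Nat.cast_nonneg (α := ℝ) j
      linarith
    have h := newton_step (x := normEsymm s j) (q := (j : ℝ) + 1 + 1) hp hq ha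
      (outer_mul_le_of_logConcave (hnn _) (hnn _) (hnn _) (hN j) (hN (j + 1))
        (hle (by omega)) (hle (by omega)))
    refine h.trans (le_of_eq ?_)
    have e : ((s.card : ℝ) + 1) ^ 2 * (normEsymm (a ::ₘ s) (j + 1 + 1) ^ 2 -
        normEsymm (a ::ₘ s) (j + 1) * normEsymm (a ::ₘ s) (j + 1 + 2)) =
        (((s.card : ℝ) + 1) * normEsymm (a ::ₘ s) (j + 1 + 1)) ^ 2 -
          (((s.card : ℝ) + 1) * normEsymm (a ::ₘ s) (j + 1)) *
          (((s.card : ℝ) + 1) * normEsymm (a ::ₘ s) (j + 1 + 1 + 1)) := by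
      ring
    rw [e, r0, r1, r2]
    ring

/-- Newton's inequalities for non-negative reals. -/
theorem newton_inequality {s : Multiset ℝ} (hs : ∀ x ∈ s, 0 ≤ x) (k : ℕ) :
    normEsymm s k * normEsymm s (k + 2) ≤ normEsymm s (k + 1) ^ 2 := by
  induction s using Multiset.induction_on generalizing k with
  | empty =>
    rw [normEsymm_eq_zero_of_card_lt (k := k + 2) (by simp), mul_zero]
    positivity
  | cons a s ih =>
    have hs' : ∀ x ∈ s, 0 ≤ x := fun x hx => hs x (Multiset.mem_cons_of_mem hx)
    by_cases hk : k + 1 ≤ s.card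
    · have h := newton_difference_cons (hs a (Multiset.mem_cons_self a s)) hs' (ih hs') hk
      have hp : (1 : ℝ) ≤ (s.card : ℝ) - k := by
        have : ((k + 1 : ℕ) : ℝ) ≤ s.card := Nat.cast_le.2 hk
        push_cast at this
        linarith
      have h1 : 0 ≤ (((s.card : ℝ) - k) ^ 2 - 1) *
          (normEsymm s (k + 1) ^ 2 - normEsymm s k * normEsymm s (k + 2)) :=
        mul_nonneg (by nlinarith) (sub_nonneg.2 (ih hs' k))
      have h2 : 0 ≤ (((k : ℝ) + 1) ^ 2 - 1) * normEsymm s k ^ 2 -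
          (((k : ℝ) + 1) ^ 2 - 1) * (normEsymm s (k - 1) * normEsymm s (k + 1)) := by
        rcases Nat.eq_zero_or_pos k with rfl | hk0
        · simp
        · obtain ⟨j, rfl⟩ : ∃ j, k = j + 1 := ⟨k - 1, by omega⟩
          rw [← mul_sub]
          refine mul_nonneg ?_ (sub_nonneg.2 (ih hs' j))
          have := Nat.cast_nonneg (α := ℝ) (j + 1)
          nlinarith
      have h3 : 0 ≤ ((s.card : ℝ) + 1) ^ 2 * (normEsymm (a ::ₘ s) (k + 1) ^ 2 -
          normEsymm (a ::ₘ s) k * normEsymm (a ::ₘ s) (k + 2)) :=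
        le_trans (by positivity) h
      exact sub_nonneg.1 (nonneg_of_mul_nonneg_right h3 (by positivity))
    · rw [normEsymm_eq_zero_of_card_lt (k := k + 2) (by simp; omega), mul_zero]
      positivity

/-- Newton's inequalities are strict unless all the elements are equal or both sides vanish. -/
theorem newton_inequality_strict {s : Multiset ℝ} (hs : ∀ x ∈ s, 0 ≤ x)
    (hne : ∀ c, s ≠ Multiset.replicate s.card c) {k : ℕ} (hk : 0 < normEsymm s (k + 1)) :
    normEsymm s k * normEsymm s (k + 2) < normEsymm s (k + 1) ^ 2 := by
  induction s using Multiset.induction_on generalizing k with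
  | empty => exact absurd rfl (hne 0)
  | cons a s ih =>
    have hs' : ∀ x ∈ s, 0 ≤ x := fun x hx => hs x (Multiset.mem_cons_of_mem hx)
    have ha := hs a (Multiset.mem_cons_self a s)
    rcases (normEsymm_nonneg hs (k + 2)).eq_or_lt with h0 | h0
    · rw [← h0, mul_zero]; positivity
    have hNa := (normEsymm_pos_iff hs _).1 h0
    have hfa : ((a ::ₘ s).filter (0 < ·)).card ≤ (s.filter (0 < ·)).card + 1 := by
      rw [Multiset.filter_cons, Multiset.card_add]
      split_ifs <;> simp [add_comm]
    have hNs : k + 1 ≤ (s.filter (0 < ·)).card := by omega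
    have hcard : k + 1 ≤ s.card := hNs.trans (Multiset.card_le_card (Multiset.filter_le _ _))
    have hz := (normEsymm_pos_iff hs' _).2 hNs
    have hN := newton_inequality hs'
    have h := newton_difference_cons ha hs' hN hcard
    have hp : (1 : ℝ) ≤ (s.card : ℝ) - k := by
      have : ((k + 1 : ℕ) : ℝ) ≤ s.card := Nat.cast_le.2 hcard
      push_cast at this
      linarith
    have h1 : 0 ≤ (((s.card : ℝ) - k) ^ 2 - 1) *
        (normEsymm s (k + 1) ^ 2 - normEsymm s k * normEsymm s (k + 2)) :=
      mul_nonneg (by nlinarith) (sub_nonneg.2 (hN k))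
    have h2 : 0 ≤ (((k : ℝ) + 1) ^ 2 - 1) * normEsymm s k ^ 2 -
        (((k : ℝ) + 1) ^ 2 - 1) * (normEsymm s (k - 1) * normEsymm s (k + 1)) := by
      rcases Nat.eq_zero_or_pos k with rfl | hk0
      · simp
      · obtain ⟨j, rfl⟩ : ∃ j, k = j + 1 := ⟨k - 1, by omega⟩
        rw [← mul_sub]
        refine mul_nonneg ?_ (sub_nonneg.2 (hN j))
        have := Nat.cast_nonneg (α := ℝ) (j + 1)
        nlinarith
    suffices h3 : 0 < ((s.card : ℝ) + 1) ^ 2 * (normEsymm (a ::ₘ s) (k + 1) ^ 2 -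
        normEsymm (a ::ₘ s) k * normEsymm (a ::ₘ s) (k + 2)) from
      sub_pos.1 (pos_of_mul_pos_right h3 (by positivity))
    refine lt_of_lt_of_le ?_ h
    -- One of the three non-negative terms in `newton_difference_cons` must be positive: the square
    -- if `s` is constant, and otherwise a Newton difference of `s`, strict by induction.
    by_cases hall : ∃ c, s = Multiset.replicate s.card c
    · obtain ⟨c, hc⟩ := hall
      have hc0 : 0 ≤ c := hs' c (by rw [hc]; exact Multiset.mem_replicate.2 ⟨by omega, rfl⟩)
      have hca : c - a ≠ 0 := by
        intro hca
        apply hne a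
        rw [Multiset.card_cons, Multiset.replicate_succ, ← sub_eq_zero.1 hca, ← hc]
      have e1 : normEsymm s (k + 1) = c ^ (k + 1) := by
        rw [hc, normEsymm_replicate hcard]
      have e0 : normEsymm s k = c ^ k := by
        rw [hc, normEsymm_replicate (by omega)]
      have hcp : 0 < c := by
        rcases hc0.eq_or_lt with h | h
        · rw [e1, ← h] at hz; simp at hz
        · exact h
      have h4 : 0 < (normEsymm s (k + 1) - a * normEsymm s k) ^ 2 := by
        have : normEsymm s (k + 1) - a * normEsymm s k = c ^ k * (c - a) := by
          rw [e1, e0]; ring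
        rw [this]
        positivity
      have := mul_nonneg (sq_nonneg a) h2
      linarith
    · push Not at hall
      by_cases hp1 : k + 1 < s.card
      · have hp2 : (2 : ℝ) ≤ (s.card : ℝ) - k := by
          have : ((k + 2 : ℕ) : ℝ) ≤ s.card := Nat.cast_le.2 hp1
          push_cast at this
          linarith
        have h4 : 0 < (((s.card : ℝ) - k) ^ 2 - 1) *
            (normEsymm s (k + 1) ^ 2 - normEsymm s k * normEsymm s (k + 2)) :=
          mul_pos (by nlinarith) (sub_pos.2 (ih hs' hall hz))
        have := mul_nonneg (sq_nonneg a) h2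
        have := sq_nonneg (normEsymm s (k + 1) - a * normEsymm s k)
        linarith
      -- Now the factor `(s.card - k)² - 1` is zero, so only the third term can help. It carries
      -- `a²`, and `a > 0` because all elements of `a ::ₘ s` must be positive for its top `ẽ` to be.
      · have hk1 : k + 1 = s.card := by omega
        have hap : 0 < a := by
          rcases ha.eq_or_lt with h5 | h5
          · rw [← h5, Multiset.filter_cons_of_neg _ (lt_irrefl _)] at hNa
            change _ ≤ (s.filter (fun x => 0 < x)).card at hNa
            have : (s.filter (fun x => 0 < x)).card ≤ s.card :=
              Multiset.card_le_card (Multiset.filter_le _ _)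
            omega
          · exact h5
        obtain ⟨j, rfl⟩ : ∃ j, k = j + 1 := by
          rcases Nat.eq_zero_or_pos k with rfl | hk0
          · obtain ⟨c, hc⟩ := Multiset.card_eq_one.1 hk1.symm
            exact absurd (by simp [hc]) (hall c)
          · exact ⟨k - 1, by omega⟩
        have hy := (normEsymm_pos_iff hs' (j + 1)).2 (by omega)
        have h5 : 0 < a ^ 2 * (((((j + 1 : ℕ) : ℝ) + 1) ^ 2 - 1) * normEsymm s (j + 1) ^ 2 -
            ((((j + 1 : ℕ) : ℝ) + 1) ^ 2 - 1) *
              (normEsymm s (j + 1 - 1) * normEsymm s (j + 1 + 1))) := by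
          rw [← mul_sub]
          refine mul_pos (by positivity) (mul_pos ?_ (sub_pos.2 (ih hs' hall hy)))
          have : (0 : ℝ) < ((j + 1 : ℕ) : ℝ) := by positivity
          nlinarith
        have := sq_nonneg (normEsymm s (j + 1 + 1) - a * normEsymm s (j + 1))
        linarith

/-! ### Powers for the finite free convolution -/

theorem signedCoeff_sum (d : ℕ) (c : ℕ → ℝ) {i : ℕ} (hi : i ≤ d) :
    signedCoeff d (∑ j ∈ Finset.range (d + 1), C ((-1) ^ j * c j) * X ^ (d - j)) i = c i := by
  rw [signedCoeff, finsetSum_coeff, Finset.sum_eq_single i]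
  · rw [coeff_C_mul, coeff_X_pow, if_pos rfl, mul_one, ← mul_assoc, ← pow_add,
      Even.neg_one_pow ⟨i, rfl⟩, one_mul]
  · intro j hj hji
    have : j ≤ d := Nat.lt_succ_iff.1 (Finset.mem_range.1 hj)
    rw [coeff_C_mul, coeff_X_pow, if_neg (by omega), mul_zero]
  · intro h
    exact absurd (Finset.mem_range.2 (by omega)) h

theorem signedCoeff_eq_esymm {d : ℕ} {p : ℝ[X]} (hm : p.Monic) (hd : p.natDegree = d)
    (hs : p.Splits) {i : ℕ} (hi : i ≤ d) : signedCoeff d p i = p.roots.esymm i := by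
  rw [signedCoeff, coeff_eq_esymm_roots_of_splits hs (by omega), hm.leadingCoeff, one_mul,
    hd, Nat.sub_sub_self hi, ← mul_assoc, ← pow_add, Even.neg_one_pow ⟨i, rfl⟩, one_mul]

/-- The signed coefficients of `p` are `binom(d,i) ẽ_i`, and the division by `binom(d,i)` in `⊠_d`
makes the convolution multiply the `ẽ_i`. -/
theorem mulConvPow_eq_sum {d : ℕ} {p : ℝ[X]} (hm : p.Monic) (hd : p.natDegree = d)
    (hs : p.Splits) (n : ℕ) :
    mulConvPow d p n = ∑ i ∈ Finset.range (d + 1),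
      C ((-1) ^ i * ((d.choose i : ℝ) * normEsymm p.roots i ^ n)) * X ^ (d - i) := by
  have hcard : p.roots.card = d := by rw [← hd, ← splits_iff_card_roots.1 hs]
  induction n with
  | zero =>
    rw [mulConvPow, sub_eq_neg_add, add_pow]
    refine Finset.sum_congr rfl fun i _ => ?_
    simp only [pow_zero, mul_one, map_mul, map_pow, map_neg, map_one, map_natCast]
    ring
  | succ n ih =>
    rw [mulConvPow, mulConv]
    refine Finset.sum_congr rfl fun i hi => ?_
    have hi' : i ≤ d := Nat.lt_succ_iff.1 (Finset.mem_range.1 hi)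
    have hc : (d.choose i : ℝ) ≠ 0 := Nat.cast_ne_zero.2 (Nat.choose_pos hi').ne'
    rw [ih, signedCoeff_sum d (fun i => (d.choose i : ℝ) * normEsymm p.roots i ^ n) hi',
      signedCoeff_eq_esymm hm hd hs hi', ← choose_mul_normEsymm (hcard ▸ hi'), hcard]
    congr 3
    field_simp
    ring

theorem eval_mulConvPow {d : ℕ} {p : ℝ[X]} (hm : p.Monic) (hd : p.natDegree = d)
    (hs : p.Splits) (n : ℕ) (x : ℝ) :
    (mulConvPow d p n).eval x = ∑ i ∈ Finset.range (d + 1),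
      (-1) ^ i * ((d.choose i : ℝ) * normEsymm p.roots i ^ n) * x ^ (d - i) := by
  simp [mulConvPow_eq_sum hm hd hs, eval_finsetSum]

theorem natDegree_mulConvPow_le {d : ℕ} {p : ℝ[X]} (hm : p.Monic) (hd : p.natDegree = d)
    (hs : p.Splits) (n : ℕ) : (mulConvPow d p n).natDegree ≤ d := by
  rw [mulConvPow_eq_sum hm hd hs]
  exact natDegree_sum_le_of_forall_le _ _ fun i _ =>
    (natDegree_C_mul_X_pow_le _ _).trans (Nat.sub_le _ _)

theorem mulConvPow_ne_zero {d : ℕ} {p : ℝ[X]} (hm : p.Monic) (hd : p.natDegree = d)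
    (hs : p.Splits) (n : ℕ) : mulConvPow d p n ≠ 0 := by
  intro h
  have h1 := signedCoeff_sum d (fun i => (d.choose i : ℝ) * normEsymm p.roots i ^ n)
    (Nat.zero_le d)
  rw [← mulConvPow_eq_sum hm hd hs, h] at h1
  simp [signedCoeff, normEsymm_zero_right] at h1

/-- If the `i`-th coefficient dominates at `r`, it determines the sign of the powers. -/
theorem eventually_sign_eval_mulConvPow {d : ℕ} {p : ℝ[X]} (hm : p.Monic)
    (hd : p.natDegree = d) (hs : p.Splits) (h0 : ∀ x ∈ p.roots, 0 ≤ x) {i : ℕ} (hi : i ≤ d)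
    {r : ℝ} (hr : 0 < r)
    (hdom : ∀ j ≤ d, j ≠ i →
      normEsymm p.roots j * r ^ (d - j) < normEsymm p.roots i * r ^ (d - i)) :
    ∀ᶠ n : ℕ in atTop, 0 < (-1) ^ i * (mulConvPow d p n).eval (r ^ n) := by
  set M : ℕ → ℝ := fun j => normEsymm p.roots j * r ^ (d - j) with hM
  have hMnn : ∀ j, 0 ≤ M j := fun j => mul_nonneg (normEsymm_nonneg h0 j) (by positivity)
  rcases (hMnn i).eq_or_lt with hMi | hMi
  · have hz : d = 0 := by
      by_contra hd0
      obtain ⟨j, hj, hji⟩ : ∃ j ≤ d, j ≠ i := by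
        rcases Nat.eq_zero_or_pos i with h | h
        · exact ⟨1, by omega, by omega⟩
        · exact ⟨0, by omega, by omega⟩
      exact absurd (hdom j hj hji) (not_lt.2 (hMi.symm.le.trans (hMnn j)))
    exfalso
    have : i = 0 := by omega
    simp [hM, this, normEsymm_zero_right] at hMi
    exact (pow_pos hr d).ne hMi
  have heval : ∀ n : ℕ, (-1) ^ i * (mulConvPow d p n).eval (r ^ n) = M i ^ n *
      ∑ j ∈ Finset.range (d + 1), (-1) ^ (i + j) * (d.choose j : ℝ) * (M j / M i) ^ n := by
    intro n
    rw [eval_mulConvPow hm hd hs, Finset.mul_sum, Finset.mul_sum]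
    refine Finset.sum_congr rfl fun j _ => ?_
    rw [div_pow]
    have : M i ^ n ≠ 0 := by positivity
    field_simp
    simp only [hM, mul_pow, ← pow_mul]
    ring
  have hlim : Tendsto (fun n : ℕ => ∑ j ∈ Finset.range (d + 1),
      (-1) ^ (i + j) * (d.choose j : ℝ) * (M j / M i) ^ n) atTop
      (𝓝 (∑ j ∈ Finset.range (d + 1), if j = i then (d.choose i : ℝ) else 0)) := by
    refine tendsto_finsetSum _ fun j hj => ?_
    split_ifs with hji
    · subst hji
      simp [div_self hMi.ne', Even.neg_one_pow (⟨j, rfl⟩ : Even (j + j))]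
    · have hlt := hdom j (Nat.lt_succ_iff.1 (Finset.mem_range.1 hj)) hji
      rw [← mul_zero ((-1) ^ (i + j) * (d.choose j : ℝ))]
      exact (tendsto_pow_atTop_nhds_zero_of_lt_one (div_nonneg (hMnn j) hMi.le)
        ((div_lt_one hMi).2 hlt)).const_mul _
  rw [Finset.sum_ite_eq' , if_pos (Finset.mem_range.2 (by omega))] at hlim
  have hpos : (0 : ℝ) < d.choose i := Nat.cast_pos.2 (Nat.choose_pos hi)
  filter_upwards [hlim.eventually (lt_mem_nhds hpos)] with n hn
  rw [heval]
  positivity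

/-- The number of positive elements of a multiset. -/
noncomputable def posCard (s : Multiset ℝ) : ℕ := (s.filter (0 < ·)).card

theorem posCard_le (s : Multiset ℝ) : posCard s ≤ s.card :=
  Multiset.card_le_card (Multiset.filter_le _ _)

/-! ### Ordering of the limit roots and localization of zeros -/

theorem limitRoot_succ (s : Multiset ℝ) (k : ℕ) :
    limitRoot s (k + 1) = normEsymm s (k + 1) / normEsymm s k := rfl

theorem limitRoot_pos {s : Multiset ℝ} (hs : ∀ x ∈ s, 0 ≤ x) {k : ℕ} (hk : k < posCard s) :
    0 < limitRoot s (k + 1) :=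
  div_pos ((normEsymm_pos_iff hs _).2 hk) ((normEsymm_pos_iff hs _).2 hk.le)

theorem limitRoot_eq_zero {s : Multiset ℝ} (hs : ∀ x ∈ s, 0 ≤ x) {k : ℕ} (hk : posCard s ≤ k) :
    limitRoot s (k + 1) = 0 := by
  have h : ¬ 0 < normEsymm s (k + 1) := fun h =>
    absurd ((normEsymm_pos_iff hs _).1 h) (not_le.2 (Nat.lt_succ_of_le hk))
  rw [limitRoot_succ, le_antisymm (not_lt.1 h) (normEsymm_nonneg hs _), zero_div]

/-- For consecutive indices this is the strict Newton inequality after clearing denominators, which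
are positive below `posCard s`. -/
theorem limitRoot_lt {s : Multiset ℝ} (hs : ∀ x ∈ s, 0 ≤ x)
    (hne : ∀ c, s ≠ Multiset.replicate s.card c) {j k : ℕ} (hjk : j < k) (hk : k < posCard s) :
    limitRoot s (k + 1) < limitRoot s (j + 1) := by
  induction k, hjk using Nat.le_induction with
  | base =>
    have h1 := (normEsymm_pos_iff hs (j + 1)).2 hk.le
    have h0 := (normEsymm_pos_iff hs j).2 (by unfold posCard at hk; omega)
    rw [limitRoot_succ, limitRoot_succ, div_lt_div_iff₀ h1 h0]
    have := newton_inequality_strict hs hne h1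
    linarith
  | succ k hjk ih =>
    refine lt_trans ?_ (ih (by omega))
    have h1 := (normEsymm_pos_iff hs (k + 1)).2 hk.le
    have h0 := (normEsymm_pos_iff hs k).2 (by unfold posCard at hk; omega)
    rw [limitRoot_succ, limitRoot_succ, div_lt_div_iff₀ h1 h0]
    have := newton_inequality_strict hs hne h1
    linarith

/-- The term of index `i` dominates between the limit roots of index `i` and `i + 1`. -/
theorem normEsymm_mul_pow_lt {s : Multiset ℝ} (hs : ∀ x ∈ s, 0 ≤ x) {i : ℕ}
    (hi : i ≤ posCard s) {r : ℝ} (hr : 0 < r) (hlt : ∀ k < i, r < limitRoot s (k + 1))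
    (hgt : ∀ k, i ≤ k → k < posCard s → limitRoot s (k + 1) < r) {j : ℕ} (hj : j ≤ s.card)
    (hji : j ≠ i) :
    normEsymm s j * r ^ (s.card - j) < normEsymm s i * r ^ (s.card - i) := by
  have hcard := posCard_le s
  rcases lt_or_gt_of_ne hji with h | h
  · clear hji
    have key : ∀ k < i, normEsymm s k * r ^ (s.card - k) <
        normEsymm s (k + 1) * r ^ (s.card - (k + 1)) := by
      intro k hk
      have hk0 := (normEsymm_pos_iff hs k).2 (by unfold posCard at hi; omega)
      have h1 := hlt k hk
      rw [limitRoot_succ, lt_div_iff₀ hk0] at h1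
      rw [show s.card - k = (s.card - (k + 1)) + 1 by omega, pow_succ]
      have : 0 < r ^ (s.card - (k + 1)) := by positivity
      nlinarith
    obtain ⟨m, rfl⟩ : ∃ m, i = j + 1 + m := ⟨i - (j + 1), by omega⟩
    clear h hgt hlt
    induction m with
    | zero => exact key j (by omega)
    | succ m ih =>
      exact (ih (by omega) fun k hk => key k (by omega)).trans (key (j + 1 + m) (by omega))
  · rcases lt_or_ge (posCard s) j with hjN | hjN
    · have h0 : normEsymm s j = 0 :=
        le_antisymm (not_lt.1 fun h => absurd ((normEsymm_pos_iff hs j).1 h) (not_le.2 hjN))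
          (normEsymm_nonneg hs j)
      have := (normEsymm_pos_iff hs i).2 hi
      rw [h0, zero_mul]
      positivity
    · clear hji
      have key : ∀ k, i ≤ k → k < posCard s → normEsymm s (k + 1) * r ^ (s.card - (k + 1)) <
          normEsymm s k * r ^ (s.card - k) := by
        intro k hik hk
        have hk0 := (normEsymm_pos_iff hs k).2 hk.le
        have h1 := hgt k hik hk
        rw [limitRoot_succ, div_lt_iff₀ hk0] at h1
        rw [show s.card - k = (s.card - (k + 1)) + 1 by omega, pow_succ]
        have : 0 < r ^ (s.card - (k + 1)) := by positivity
        nlinarith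
      obtain ⟨m, rfl⟩ : ∃ m, j = i + 1 + m := ⟨j - (i + 1), by omega⟩
      clear h hj
      induction m with
      | zero => exact key i le_rfl (by omega)
      | succ m ih => exact (key (i + 1 + m) (by omega) (by omega)).trans (ih (by omega))

/-- If a polynomial of degree at most `d` has `N` distinct positive zeros and a zero of
multiplicity `d - N` at `0`, these are all its zeros. -/
theorem nthRoot_eq {q : ℝ[X]} (hq : q ≠ 0) {d N : ℕ} (hdeg : q.natDegree ≤ d) (hN : N ≤ d)
    {x : ℕ → ℝ} (hpos : ∀ k < N, 0 < x k) (hanti : ∀ j k, j < k → k < N → x k < x j)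
    (hroot : ∀ k < N, q.IsRoot (x k)) (hX : X ^ (d - N) ∣ q) (k : ℕ) :
    nthRoot q (k + 1) = if k < N then x k else 0 := by
  classical
  -- The predicted zeros in decreasing order, those at the origin included. As `L` embeds in the
  -- multiset of roots and has length `d`, the degree bound forces equality.
  set L : List ℝ := (List.range N).map x ++ List.replicate (d - N) 0 with hL
  have hnodup : ((List.range N).map x).Nodup := by
    refine List.Nodup.map_on ?_ List.nodup_range
    intro j hj k hk hjk
    rw [List.mem_range] at hj hk
    rcases lt_trichotomy j k with h | h | h
    · exact absurd hjk (hanti j k h hk).ne'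
    · exact h
    · exact absurd hjk (hanti k j h hj).ne
  have hle : (L : Multiset ℝ) ≤ q.roots := by
    rw [Multiset.le_iff_count]
    intro y
    rw [Multiset.coe_count, hL, List.count_append, List.count_replicate]
    by_cases hy : y = 0
    · subst hy
      have h1 : ((List.range N).map x).count 0 = 0 := by
        rw [List.count_eq_zero, List.mem_map]
        rintro ⟨k, hk, h⟩
        exact (hpos k (List.mem_range.1 hk)).ne' h
      rw [h1, zero_add, count_roots]
      simp only [BEq.rfl, if_true]
      rw [le_rootMultiplicity_iff hq, C_0, sub_zero]
      exact hX
    · rw [if_neg (by simpa using fun h : (0 : ℝ) = y => hy h.symm), add_zero]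
      by_cases hmem : y ∈ (List.range N).map x
      · refine (List.nodup_iff_count_le_one.1 hnodup y).trans ?_
        rw [Multiset.one_le_count_iff_mem, mem_roots hq]
        obtain ⟨k, hk, rfl⟩ := List.mem_map.1 hmem
        exact hroot k (List.mem_range.1 hk)
      · rw [List.count_eq_zero.2 hmem]
        exact Nat.zero_le _
  have heq : q.roots = (L : Multiset ℝ) := by
    refine (Multiset.eq_of_le_of_card_le hle ?_).symm
    have : L.length = d := by simp [hL, hN]
    rw [Multiset.coe_card, this]
    exact (card_roots' q).trans hdeg
  have hsorted : L.Pairwise (· ≥ ·) := by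
    rw [hL, List.pairwise_append]
    refine ⟨?_, ?_, ?_⟩
    · rw [List.pairwise_map]
      refine List.Pairwise.imp_of_mem ?_ (List.pairwise_lt_range (n := N))
      intro j k _ hk hjk
      exact (hanti j k hjk (List.mem_range.1 hk)).le
    · exact List.pairwise_replicate.2 (Or.inr (le_refl _))
    · intro a ha b hb
      obtain ⟨k, hk, rfl⟩ := List.mem_map.1 ha
      rw [List.eq_of_mem_replicate hb]
      exact (hpos k (List.mem_range.1 hk)).le
  have hsort : q.roots.sort (· ≥ ·) = L := by
    rw [heq, Multiset.coe_sort]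
    exact List.mergeSort_eq_self _ hsorted
  rw [nthRoot, hsort, Nat.add_sub_cancel, hL]
  split_ifs with h
  · rw [List.getD_append _ _ _ _ (by simpa using h)]
    simp [List.getD, h]
  · rw [List.getD_append_right _ _ _ _ (by simpa using h)]
    simp [List.getD, List.getElem?_replicate]
    split_ifs <;> rfl

theorem nthRoot_X_sub_C_pow {d k : ℕ} (hk : k < d) (c : ℝ) :
    nthRoot ((X - C c) ^ d) (k + 1) = c := by
  have hroots : ((X - C c) ^ d : ℝ[X]).roots = ((List.replicate d c : List ℝ) : Multiset ℝ) := by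
    rw [roots_pow, roots_X_sub_C, Multiset.nsmul_singleton, Multiset.coe_replicate]
  rw [nthRoot, hroots, Multiset.coe_sort,
    List.mergeSort_eq_self (· ≥ ·) (List.pairwise_replicate.2 (Or.inr (le_refl _)))]
  simp [List.getD, hk]

/-- For `n` large the zeros of the `n`-th power are confined to small intervals around the `n`-th
powers of the limit roots. -/
theorem eventually_exists_roots {d : ℕ} {p : ℝ[X]} (hm : p.Monic)
    (hd : p.natDegree = d) (hs : p.Splits) (h0 : ∀ x ∈ p.roots, 0 ≤ x) {δ : ℝ}
    (hδ : 0 < δ) (hδu : ∀ k < posCard p.roots, δ < limitRoot p.roots (k + 1))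
    (hgap : ∀ j k, j < k → k < posCard p.roots →
      2 * δ < limitRoot p.roots (j + 1) - limitRoot p.roots (k + 1)) :
    ∀ᶠ n : ℕ in atTop, ∀ k < posCard p.roots, ∃ x ∈ Set.Ioo
      ((limitRoot p.roots (k + 1) - δ) ^ n) ((limitRoot p.roots (k + 1) + δ) ^ n),
      (mulConvPow d p n).IsRoot x := by
  have hcard : p.roots.card = d := by rw [← hd, ← splits_iff_card_roots.1 hs]
  have hN := posCard_le p.roots
  rw [hcard] at hN
  have hmono : ∀ j k, j ≤ k → k < posCard p.roots →
      limitRoot p.roots (k + 1) ≤ limitRoot p.roots (j + 1) := by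
    intro j k hjk hk
    rcases hjk.eq_or_lt with rfl | h
    · exact le_rfl
    · linarith [hgap j k h hk]
  have h1 : ∀ k ∈ Finset.range (posCard p.roots), ∀ᶠ n : ℕ in atTop, ∃ x ∈ Set.Ioo
      ((limitRoot p.roots (k + 1) - δ) ^ n) ((limitRoot p.roots (k + 1) + δ) ^ n),
      (mulConvPow d p n).IsRoot x := by
    intro k hk
    rw [Finset.mem_range] at hk
    have hu := hδu k hk
    -- Index `k + 1` dominates just below `limitRoot p.roots (k + 1)` and index `k` just above it,
    -- so the signs are opposite.
    have ha := eventually_sign_eval_mulConvPow hm hd hs h0 (i := k + 1) (by omega)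
      (sub_pos.2 hu) (fun j hj hji => by
        have := normEsymm_mul_pow_lt h0 (i := k + 1) hk (sub_pos.2 hu)
          (fun l hl => by linarith [hmono l k (by omega) hk])
          (fun l hl hlN => by linarith [hgap k l (by omega) hlN]) (hcard ▸ hj) hji
        rwa [hcard] at this)
    have hb := eventually_sign_eval_mulConvPow hm hd hs h0 (i := k) (by omega)
      (r := limitRoot p.roots (k + 1) + δ) (by linarith) (fun j hj hji => by
        have := normEsymm_mul_pow_lt h0 (i := k) hk.le
          (r := limitRoot p.roots (k + 1) + δ) (by linarith)
          (fun l hl => by linarith [hgap l k (by omega) hk])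
          (fun l hl hlN => by linarith [hmono k l hl hlN]) (hcard ▸ hj) hji
        rwa [hcard] at this)
    filter_upwards [ha, hb] with n hna hnb
    have hab : (limitRoot p.roots (k + 1) - δ) ^ n ≤ (limitRoot p.roots (k + 1) + δ) ^ n :=
      pow_le_pow_left₀ (by linarith) (by linarith) n
    have hcont : ContinuousOn (fun x => (-1) ^ k * (mulConvPow d p n).eval x)
        (Set.Icc ((limitRoot p.roots (k + 1) - δ) ^ n)
          ((limitRoot p.roots (k + 1) + δ) ^ n)) :=
      (continuous_const.mul (mulConvPow d p n).continuous).continuousOn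
    obtain ⟨x, hx, hx0⟩ := intermediate_value_Ioo hab hcont
      (show (0 : ℝ) ∈ _ from ⟨by rw [pow_succ] at hna; linarith, hnb⟩)
    exact ⟨x, hx, (mul_eq_zero.1 hx0).resolve_left (pow_ne_zero _ (by norm_num))⟩
  filter_upwards [(Filter.eventually_all_finset _).2 h1] with n hn k hk
  exact hn k (Finset.mem_range.2 hk)

/-- The limit roots of a polynomial with non-negative zeros. -/
theorem tendsto_nthRoot_mulConvPow {d : ℕ} {p : ℝ[X]} (hm : p.Monic)
    (hd : p.natDegree = d) (hs : p.Splits) (h0 : ∀ x ∈ p.roots, 0 ≤ x) {k : ℕ} (hk : k < d) :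
    Tendsto (fun n : ℕ => (nthRoot (mulConvPow d p n) (k + 1)) ^ (1 / (n : ℝ))) atTop
      (𝓝 (limitRoot p.roots (k + 1))) := by
  have hcard : p.roots.card = d := by rw [← hd, ← splits_iff_card_roots.1 hs]
  -- If all roots equal `c`, so do the limit roots, and no sign change is available; but then the
  -- power is explicitly `(x - c^n)^d`.
  by_cases hall : ∃ c, p.roots = Multiset.replicate p.roots.card c
  · obtain ⟨c, hc⟩ := hall
    rw [hcard] at hc
    have hc0 : 0 ≤ c := h0 c (by rw [hc]; exact Multiset.mem_replicate.2 ⟨by omega, rfl⟩)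
    have hlim : limitRoot p.roots (k + 1) = c := by
      rw [limitRoot_succ, hc, normEsymm_replicate hk, normEsymm_replicate hk.le]
      rcases hc0.eq_or_lt with h | h
      · simp [← h]
      · rw [pow_succ, mul_div_cancel_left₀]
        positivity
    rw [hlim]
    refine tendsto_const_nhds.congr' ?_
    filter_upwards [eventually_ne_atTop 0] with n hn
    have hpow : mulConvPow d p n = (X - C (c ^ n)) ^ d := by
      rw [mulConvPow_eq_sum hm hd hs, sub_eq_neg_add, add_pow]
      refine Finset.sum_congr rfl fun i hi => ?_
      rw [hc, normEsymm_replicate (Nat.lt_succ_iff.1 (Finset.mem_range.1 hi))]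
      simp only [map_mul, map_pow, map_neg, map_one, map_natCast]
      rw [neg_pow (C c ^ n)]
      ring
    rw [hpow, nthRoot_X_sub_C_pow hk, one_div, Real.pow_rpow_inv_natCast hc0 hn]
  · push Not at hall
    set u : ℕ → ℝ := fun k => limitRoot p.roots (k + 1) with hu
    set N := posCard p.roots with hNdef
    have hN : N ≤ d := hcard ▸ posCard_le p.roots
    have hupos : ∀ k < N, 0 < u k := fun k hk => limitRoot_pos h0 hk
    have hult : ∀ j k, j < k → k < N → u k < u j := fun j k hjk hk => limitRoot_lt h0 hall hjk hk
    rw [Metric.tendsto_nhds]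
    intro ε hε
    have hsmall : ∀ c : ℝ, 0 < c → ∀ᶠ δ : ℝ in 𝓝[>] 0, δ < c := fun c hc =>
      (eventually_lt_nhds hc).filter_mono nhdsWithin_le_nhds
    -- With `δ` below every positive limit root and below half of every gap, the intervals around
    -- the limit roots are positive and disjoint, which keeps the zeros found in them distinct and
    -- ordered.
    have h1 : ∀ᶠ δ : ℝ in 𝓝[>] 0, ∀ k ∈ Finset.range N, δ < u k :=
      (Filter.eventually_all_finset _).2 fun k hk => hsmall _ (hupos k (Finset.mem_range.1 hk))
    have h2 : ∀ᶠ δ : ℝ in 𝓝[>] 0, ∀ k ∈ Finset.range N, ∀ j ∈ Finset.range k,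
        δ < (u j - u k) / 2 :=
      (Filter.eventually_all_finset _).2 fun k hk => (Filter.eventually_all_finset _).2
        fun j hj => hsmall _ (half_pos (sub_pos.2
          (hult j k (Finset.mem_range.1 hj) (Finset.mem_range.1 hk))))
    obtain ⟨δ, ⟨⟨⟨hδu, hδgap⟩, hδε⟩, hδ⟩⟩ :=
      (((h1.and h2).and (hsmall ε hε)).and self_mem_nhdsWithin).exists
    have hδ : 0 < δ := hδ
    filter_upwards [eventually_exists_roots hm hd hs h0 hδ
      (fun k hk => hδu k (Finset.mem_range.2 hk))
      (fun j k hjk hk => by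
        have := hδgap k (Finset.mem_range.2 hk) j (Finset.mem_range.2 hjk)
        simp only [hu] at this
        linarith), eventually_ne_atTop 0] with n hn hn0
    choose! x hxI hxroot using hn
    have hxpos : ∀ k < N, 0 < x k := fun k hk =>
      (pow_pos (sub_pos.2 (hδu k (Finset.mem_range.2 hk))) n).trans (hxI k hk).1
    -- Coefficients of index above `N` contain `ẽ_i ^ n` with `ẽ_i = 0`; this is zero because `n ≠
    -- 0`.
    have hX : X ^ (d - N) ∣ mulConvPow d p n := by
      rw [mulConvPow_eq_sum hm hd hs]
      refine Finset.dvd_sum fun i _ => ?_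
      rcases le_or_gt i N with hi | hi
      · exact (pow_dvd_pow X (by omega)).mul_left _
      · have : normEsymm p.roots i = 0 :=
          le_antisymm (not_lt.1 fun h => absurd ((normEsymm_pos_iff h0 i).1 h) (not_le.2 hi))
            (normEsymm_nonneg h0 i)
        simp [this, hn0]
    rw [nthRoot_eq (mulConvPow_ne_zero hm hd hs n) (natDegree_mulConvPow_le hm hd hs n) hN hxpos
      (fun j k hjk hkN => ?_) hxroot hX]
    · split_ifs with hkN
      · have hI := hxI k hkN
        have hδk := hδu k (Finset.mem_range.2 hkN)
        have hpos := hxpos k hkN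
        have hn' : (0 : ℝ) < (n : ℝ)⁻¹ := by positivity
        have e1 := Real.rpow_lt_rpow (by have := sub_pos.2 hδk; positivity) hI.1 hn'
        have e2 := Real.rpow_lt_rpow hpos.le hI.2 hn'
        rw [Real.pow_rpow_inv_natCast (by simp only [hu] at hδk; linarith) hn0] at e1
        rw [Real.pow_rpow_inv_natCast (by simp only [hu] at hδk; linarith) hn0] at e2
        rw [one_div, Real.dist_eq, abs_lt]
        constructor <;> linarith
      · rw [Real.zero_rpow (by simpa using hn0), limitRoot_eq_zero h0 (not_lt.1 hkN), dist_self]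
        exact hε
    · have hg := hδgap k (Finset.mem_range.2 hkN) j (Finset.mem_range.2 hjk)
      have hδj := hδu j (Finset.mem_range.2 (hjk.trans hkN))
      have hδk := hδu k (Finset.mem_range.2 hkN)
      simp only [hu] at hg hδj hδk
      exact ((hxI k hkN).2.trans_le (pow_le_pow_left₀ (by linarith) (by linarith) n)).trans
        (hxI j (hjk.trans hkN)).1

/-! ### The transform `∫ 1/(1+sx)`, its inverse and the S-transform -/

theorem ae_pos_of_measure {ρ : Measure ℝ} (hneg : ρ (Set.Iio 0) = 0) (h0 : ρ {0} = 0) :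
    ∀ᵐ x ∂ρ, 0 < x := by
  rw [ae_iff]
  refine measure_mono_null (fun x hx => ?_) (measure_union_null hneg h0)
  rcases (not_lt.1 hx).lt_or_eq with h | h
  · exact Or.inl h
  · exact Or.inr h

/-- The transform `s ↦ ∫ 1 / (1 + s x) ρ(dx)`, equal to `1 + ψ_ρ(-s)`. -/
noncomputable def stieltjes (ρ : Measure ℝ) (s : ℝ) : ℝ := ∫ x, 1 / (1 + s * x) ∂ρ

section Positive

variable {ρ : Measure ℝ}

theorem stieltjes_kernel_bound {s x : ℝ} (hs : 0 ≤ s) (hx : 0 < x) :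
    ‖1 / (1 + s * x)‖ ≤ 1 := by
  have : 0 ≤ s * x := by positivity
  rw [Real.norm_of_nonneg (by positivity), div_le_one (by positivity)]
  linarith

theorem aestronglyMeasurable_stieltjes_kernel (s : ℝ) :
    AEStronglyMeasurable (fun x => 1 / (1 + s * x)) ρ :=
  (by fun_prop : Measurable fun x : ℝ => 1 / (1 + s * x)).aestronglyMeasurable

theorem integrable_stieltjes_kernel [IsFiniteMeasure ρ] (hpos : ∀ᵐ x ∂ρ, 0 < x) {s : ℝ}
    (hs : 0 ≤ s) : Integrable (fun x => 1 / (1 + s * x)) ρ := by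
  refine Integrable.of_bound (aestronglyMeasurable_stieltjes_kernel s) 1 ?_
  filter_upwards [hpos] with x hx using stieltjes_kernel_bound hs hx

variable [IsProbabilityMeasure ρ]

theorem psi_neg (hpos : ∀ᵐ x ∂ρ, 0 < x) {s : ℝ} (hs : 0 ≤ s) :
    psi ρ (-s) = stieltjes ρ s - 1 := by
  have h1 : ∫ x, (1 / (1 + s * x) - 1) ∂ρ = stieltjes ρ s - 1 := by
    rw [integral_sub (integrable_stieltjes_kernel hpos hs) (integrable_const _)]
    simp [stieltjes]
  rw [← h1, psi]
  refine integral_congr_ae ?_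
  filter_upwards [hpos] with x hx
  have h2 : 0 < 1 + s * x := by positivity
  have h3 : 1 - x * -s ≠ 0 := by nlinarith
  rw [div_eq_iff h3]
  field_simp
  ring

theorem continuousOn_stieltjes (hpos : ∀ᵐ x ∂ρ, 0 < x) :
    ContinuousOn (stieltjes ρ) (Set.Ici 0) := by
  refine continuousOn_of_dominated (bound := fun _ => 1) (fun s _ => aestronglyMeasurable_stieltjes_kernel s)
    (fun s hs => ?_) (integrable_const _) ?_
  · filter_upwards [hpos] with x hx using stieltjes_kernel_bound hs hx
  · filter_upwards [hpos] with x hx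
    refine ContinuousOn.div continuousOn_const (by fun_prop) fun s hs => ?_
    have hs' : 0 ≤ s := hs
    positivity

theorem tendsto_stieltjes_atTop (hpos : ∀ᵐ x ∂ρ, 0 < x) :
    Tendsto (stieltjes ρ) atTop (𝓝 0) := by
  have h := tendsto_integral_filter_of_dominated_convergence (μ := ρ) (l := atTop)
    (F := fun s x => 1 / (1 + s * x)) (f := fun _ => (0 : ℝ)) (fun _ => 1)
    (Eventually.of_forall aestronglyMeasurable_stieltjes_kernel)
    (by
      filter_upwards [eventually_ge_atTop 0] with s hs
      filter_upwards [hpos] with x hx using stieltjes_kernel_bound hs hx)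
    (integrable_const _)
    (by
      filter_upwards [hpos] with x hx
      exact tendsto_const_nhds.div_atTop
        (tendsto_atTop_add_const_left _ _ (tendsto_id.atTop_mul_const hx)))
  rwa [integral_zero] at h

theorem integral_pos_of_ae_pos {f : ℝ → ℝ} (hf : Integrable f ρ) (h : ∀ᵐ x ∂ρ, 0 < f x) :
    0 < ∫ x, f x ∂ρ := by
  rw [integral_pos_iff_support_of_nonneg_ae (h.mono fun x hx => hx.le) hf]
  refine pos_iff_ne_zero.2 fun h0 => ?_
  have h1 : ∀ᵐ x ∂ρ, f x = 0 := h0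
  obtain ⟨x, hx, hx0⟩ := (h.and h1).exists
  exact hx.ne' hx0

theorem stieltjes_pos (hpos : ∀ᵐ x ∂ρ, 0 < x) {s : ℝ} (hs : 0 ≤ s) : 0 < stieltjes ρ s := by
  refine integral_pos_of_ae_pos (integrable_stieltjes_kernel hpos hs) ?_
  filter_upwards [hpos] with x hx
  positivity

theorem stieltjes_lt (hpos : ∀ᵐ x ∂ρ, 0 < x) {s s' : ℝ} (hs : 0 ≤ s) (hss : s < s') :
    stieltjes ρ s' < stieltjes ρ s := by
  have hi := integrable_stieltjes_kernel (ρ := ρ) hpos hs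
  have hi' := integrable_stieltjes_kernel (ρ := ρ) hpos (hs.trans hss.le)
  rw [← sub_pos, stieltjes, stieltjes, ← integral_sub hi hi']
  refine integral_pos_of_ae_pos (hi.sub hi') ?_
  filter_upwards [hpos] with x hx
  refine sub_pos.2 (one_div_lt_one_div_of_lt (by positivity) ?_)
  nlinarith

theorem exists_stieltjes_eq (hpos : ∀ᵐ x ∂ρ, 0 < x) {t : ℝ} (ht : t ∈ Set.Ioo (0 : ℝ) 1) :
    ∃ s, 0 < s ∧ stieltjes ρ s = t := by
  obtain ⟨S, hS, hS0⟩ := (((tendsto_stieltjes_atTop hpos).eventually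
    (gt_mem_nhds ht.1)).and (eventually_ge_atTop 0)).exists
  have h0 : stieltjes ρ 0 = 1 := by simp [stieltjes]
  obtain ⟨s, hs, hst⟩ := intermediate_value_Icc' hS0
    ((continuousOn_stieltjes hpos).mono Set.Icc_subset_Ici_self)
    (show t ∈ Set.Icc (stieltjes ρ S) (stieltjes ρ 0) from ⟨hS.le, by rw [h0]; exact ht.2.le⟩)
  refine ⟨s, lt_of_le_of_ne hs.1 ?_, hst⟩
  rintro rfl
  rw [h0] at hst
  exact ht.2.ne hst.symm

/-- The inverse function of `stieltjes ρ`. -/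
noncomputable def quant (ρ : Measure ℝ) (t : ℝ) : ℝ := -psiInv ρ (t - 1)

theorem quant_spec (hpos : ∀ᵐ x ∂ρ, 0 < x) {t : ℝ} (ht : t ∈ Set.Ioo (0 : ℝ) 1) :
    0 < quant ρ t ∧ stieltjes ρ (quant ρ t) = t := by
  obtain ⟨s, hs, hst⟩ := exists_stieltjes_eq hpos ht
  have hmem : t - 1 ∈ psi ρ '' Set.Iio 0 :=
    ⟨-s, by simpa using hs, by rw [psi_neg hpos hs.le, hst]⟩
  have h1 : psiInv ρ (t - 1) < 0 := Function.invFunOn_mem hmem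
  have h2 : psi ρ (psiInv ρ (t - 1)) = t - 1 := Function.invFunOn_eq hmem
  have h3 : 0 < quant ρ t := neg_pos.2 h1
  refine ⟨h3, ?_⟩
  have h4 := psi_neg hpos h3.le
  rw [quant, neg_neg, h2] at h4
  rw [quant]
  linarith

/-- Strict monotonicity turns inversion into an equivalence of inequalities; monotonicity of `quant`
and the tail probabilities in `map_quant_eq` are read off from it. -/
theorem le_quant_iff (hpos : ∀ᵐ x ∂ρ, 0 < x) {t s : ℝ} (ht : t ∈ Set.Ioo (0 : ℝ) 1)
    (hs : 0 ≤ s) : s ≤ quant ρ t ↔ t ≤ stieltjes ρ s := by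
  obtain ⟨h1, h2⟩ := quant_spec hpos ht
  constructor
  · intro h
    rcases h.eq_or_lt with h | h
    · rw [h, h2]
    · exact h2 ▸ (stieltjes_lt hpos hs h).le
  · intro h
    by_contra hlt
    exact absurd (h2 ▸ stieltjes_lt hpos h1.le (not_le.1 hlt)) (not_lt.2 h)

theorem quant_lt (hpos : ∀ᵐ x ∂ρ, 0 < x) {t t' : ℝ} (ht : 0 < t) (ht' : t' < 1) (h : t < t') :
    quant ρ t' < quant ρ t := by
  have h1 := quant_spec (ρ := ρ) hpos (t := t) ⟨ht, h.trans ht'⟩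
  rw [← not_le, le_quant_iff hpos ⟨ht.trans h, ht'⟩ h1.1.le, h1.2]
  exact not_le.2 h

theorem sTransform_sub_one (ρ : Measure ℝ) (t : ℝ) :
    sTransform ρ (t - 1) = t / (1 - t) * quant ρ t := by
  rw [sTransform, quant, sub_add_cancel, ← neg_sub 1 t, div_neg]
  ring

theorem sTransform_pos (hpos : ∀ᵐ x ∂ρ, 0 < x) {t : ℝ} (ht : t ∈ Set.Ioo (0 : ℝ) 1) :
    0 < sTransform ρ (t - 1) := by
  rw [sTransform_sub_one]
  exact mul_pos (div_pos ht.1 (sub_pos.2 ht.2)) (quant_spec hpos ht).1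

/-- The quotient `(∫ x / (1 + s x) ρ(dx)) / (∫ 1 / (1 + s x) ρ(dx))`. -/
noncomputable def tiltedMean (ρ : Measure ℝ) (s : ℝ) : ℝ :=
  (∫ x, x / (1 + s * x) ∂ρ) / stieltjes ρ s

theorem integral_div_eq (hpos : ∀ᵐ x ∂ρ, 0 < x) {s : ℝ} (hs : 0 < s) :
    ∫ x, x / (1 + s * x) ∂ρ = (1 - stieltjes ρ s) / s := by
  have h1 : ∫ x, (1 - 1 / (1 + s * x)) ∂ρ = 1 - stieltjes ρ s := by
    rw [integral_sub (integrable_const _) (integrable_stieltjes_kernel hpos hs.le)]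
    simp [stieltjes]
  rw [← h1, ← integral_div]
  refine integral_congr_ae ?_
  filter_upwards [hpos] with x hx
  field_simp
  ring

theorem integrable_div (hpos : ∀ᵐ x ∂ρ, 0 < x) {s : ℝ} (hs : 0 < s) :
    Integrable (fun x => x / (1 + s * x)) ρ := by
  have h := ((integrable_const (μ := ρ) (1 : ℝ)).sub
    (integrable_stieltjes_kernel hpos hs.le)).div_const s
  refine h.congr ?_
  filter_upwards [hpos] with x hx
  simp only [Pi.sub_apply]
  field_simp
  ring

/-- At `s = quant ρ t` the mass `∫ 1/(1+sx)` is `t`, and `∫ x/(1+sx)` is `(1-t)/s`. Seeing `1/S` as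
a weighted mean of `x` is what makes its bounds and monotonicity accessible. -/
theorem one_div_sTransform (hpos : ∀ᵐ x ∂ρ, 0 < x) {t : ℝ} (ht : t ∈ Set.Ioo (0 : ℝ) 1) :
    1 / sTransform ρ (t - 1) = tiltedMean ρ (quant ρ t) := by
  obtain ⟨h1, h2⟩ := quant_spec hpos ht
  rw [tiltedMean, integral_div_eq hpos h1, h2, sTransform_sub_one]
  have := ht.1
  have := sub_pos.2 ht.2
  field_simp

theorem tiltedMean_mem_Icc {a b : ℝ} (ha : 0 < a) (hab : ∀ᵐ x ∂ρ, x ∈ Set.Icc a b) {s : ℝ}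
    (hs : 0 < s) : tiltedMean ρ s ∈ Set.Icc a b := by
  have hpos : ∀ᵐ x ∂ρ, 0 < x := hab.mono fun x hx => ha.trans_le hx.1
  have hA := stieltjes_pos hpos hs.le
  have hi := integrable_stieltjes_kernel (ρ := ρ) hpos hs.le
  constructor
  · rw [tiltedMean, le_div_iff₀ hA, stieltjes, ← integral_const_mul]
    refine integral_mono_ae (hi.const_mul a) (integrable_div hpos hs) ?_
    filter_upwards [hab] with x hx
    have : 0 < x := ha.trans_le hx.1
    rw [mul_one_div]
    have := hx.1
    gcongr
  · rw [tiltedMean, div_le_iff₀ hA, stieltjes, ← integral_const_mul]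
    refine integral_mono_ae (integrable_div hpos hs) (hi.const_mul b) ?_
    filter_upwards [hab] with x hx
    have : 0 < x := ha.trans_le hx.1
    rw [mul_one_div]
    have := hx.2
    gcongr

theorem eq_dirac_of_ae_eq {m : ℝ} (h : ∀ᵐ x ∂ρ, x = m) : ρ = Measure.dirac m := by
  have h1 : ρ.map id = ρ.map (fun _ => m) := Measure.map_congr h
  rwa [Measure.map_id, Measure.map_const, measure_univ, one_smul] at h1

/-- Raising `s` shifts relative weight towards small `x`. The claim amounts to `∫ (x - m)/(1 + s' x)
dρ < 0`, where `m` is the mean at `s`. -/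
theorem tiltedMean_lt {a b : ℝ} (ha : 0 < a) (hab : ∀ᵐ x ∂ρ, x ∈ Set.Icc a b)
    (hne : ∀ c, ρ ≠ Measure.dirac c) {s s' : ℝ} (hs : 0 < s) (hss : s < s') :
    tiltedMean ρ s' < tiltedMean ρ s := by
  have hpos : ∀ᵐ x ∂ρ, 0 < x := hab.mono fun x hx => ha.trans_le hx.1
  have hs' := hs.trans hss
  set m := tiltedMean ρ s with hm
  have hm0 : 0 < m := ha.trans_le (tiltedMean_mem_Icc ha hab hs).1
  have hint : ∀ {r : ℝ}, 0 < r → Integrable (fun x => (x - m) / (1 + r * x)) ρ := by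
    intro r hr
    refine ((integrable_div hpos hr).sub
      ((integrable_stieltjes_kernel hpos hr.le).const_mul m)).congr ?_
    filter_upwards with x
    simp only [Pi.sub_apply]
    ring
  have heq : ∀ {r : ℝ}, 0 < r → ∫ x, (x - m) / (1 + r * x) ∂ρ =
      (∫ x, x / (1 + r * x) ∂ρ) - m * stieltjes ρ r := by
    intro r hr
    rw [stieltjes, ← integral_const_mul, ← integral_sub (integrable_div hpos hr)
      ((integrable_stieltjes_kernel hpos hr.le).const_mul m)]
    refine integral_congr_ae ?_
    filter_upwards with x
    ring
  have hzero : ∫ x, (x - m) / (1 + s * x) ∂ρ = 0 := by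
    rw [heq hs, hm, tiltedMean, div_mul_cancel₀ _ (stieltjes_pos hpos hs.le).ne', sub_self]
  rw [tiltedMean, div_lt_iff₀ (stieltjes_pos hpos hs'.le), ← sub_neg, ← heq hs']
  -- The weight makes `w/(1+sx) - 1/(1+s'x)` vanish at `x = m`, so the combined integrand is a
  -- positive multiple of `(x-m)²`. It integrates to zero only if `x = m` almost everywhere.
  set w : ℝ := (1 + s * m) / (1 + s' * m) with hw
  have hwint : Integrable (fun x => w * ((x - m) / (1 + s * x)) - (x - m) / (1 + s' * x)) ρ :=
    ((hint hs).const_mul w).sub (hint hs')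
  have hval : ∀ᵐ x ∂ρ, w * ((x - m) / (1 + s * x)) - (x - m) / (1 + s' * x) =
      (s' - s) * (x - m) ^ 2 / ((1 + s * x) * (1 + s' * x) * (1 + s' * m)) := by
    filter_upwards [hpos] with x hx
    rw [hw]
    field_simp
    ring
  have hnn : ∀ᵐ x ∂ρ, 0 ≤ w * ((x - m) / (1 + s * x)) - (x - m) / (1 + s' * x) := by
    filter_upwards [hpos, hval] with x hx h
    rw [h]
    have := sub_pos.2 hss
    positivity
  have hI : ∫ x, (w * ((x - m) / (1 + s * x)) - (x - m) / (1 + s' * x)) ∂ρ =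
      -∫ x, (x - m) / (1 + s' * x) ∂ρ := by
    rw [integral_sub ((hint hs).const_mul w) (hint hs'), integral_const_mul, hzero]
    ring
  have hI0 := integral_nonneg_of_ae hnn
  rcases hI0.eq_or_lt with h | h
  · exfalso
    have h1 := (integral_eq_zero_iff_of_nonneg_ae hnn hwint).1 h.symm
    refine hne m (eq_dirac_of_ae_eq ?_)
    filter_upwards [hpos, hval, h1] with x hx h2 h3
    rw [h2] at h3
    have h4 : 0 < s' - s := sub_pos.2 hss
    have h5 : 0 < (1 + s * x) * (1 + s' * x) * (1 + s' * m) := by positivity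
    rw [Pi.zero_apply, div_eq_zero_iff] at h3
    rcases h3 with h3 | h3
    · have := (mul_eq_zero.1 h3).resolve_left h4.ne'
      exact sub_eq_zero.1 (pow_eq_zero_iff two_ne_zero |>.1 this)
    · exact absurd h3 h5.ne'
  · rw [hI] at h
    linarith

end Positive

/-- The quantile function `t ↦ 1 / S_μ(t - 1)` of the limit law. -/
noncomputable def limitQuantile (μ : Measure ℝ) (t : ℝ) : ℝ := 1 / sTransform μ (t - 1)

/-! ### The quantile function `1/S_μ(t-1)` -/

section Quantile

variable {μ : Measure ℝ} [IsProbabilityMeasure μ] {a b : ℝ}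

theorem limitQuantile_mem_Icc (ha : 0 < a) (hab : ∀ᵐ x ∂μ, x ∈ Set.Icc a b) {t : ℝ}
    (ht : t ∈ Set.Ioo (0 : ℝ) 1) : limitQuantile μ t ∈ Set.Icc a b := by
  have hpos : ∀ᵐ x ∂μ, 0 < x := hab.mono fun x hx => ha.trans_le hx.1
  rw [limitQuantile, one_div_sTransform hpos ht]
  exact tiltedMean_mem_Icc ha hab (quant_spec hpos ht).1

theorem strictMonoOn_limitQuantile (ha : 0 < a) (hab : ∀ᵐ x ∂μ, x ∈ Set.Icc a b)
    (hne : ∀ c, μ ≠ Measure.dirac c) :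
    StrictMonoOn (limitQuantile μ) (Set.Ioo 0 1) := by
  have hpos : ∀ᵐ x ∂μ, 0 < x := hab.mono fun x hx => ha.trans_le hx.1
  intro t ht t' ht' htt
  rw [limitQuantile, limitQuantile, one_div_sTransform hpos ht, one_div_sTransform hpos ht']
  exact tiltedMean_lt ha hab hne (quant_spec hpos ht').1 (quant_lt hpos ht.1 ht'.2 htt)

theorem tiltedMean_dirac {c s : ℝ} (hc : 0 < c) (hs : 0 < s) :
    tiltedMean (Measure.dirac c) s = c := by
  rw [tiltedMean, stieltjes, integral_dirac, integral_dirac]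
  field_simp

theorem limitQuantile_dirac {c t : ℝ} (hc : 0 < c) (ht : t ∈ Set.Ioo (0 : ℝ) 1) :
    limitQuantile (Measure.dirac c) t = c := by
  have hpos : ∀ᵐ x ∂Measure.dirac c, 0 < x := by simpa [ae_dirac_eq] using hc
  rw [limitQuantile, one_div_sTransform hpos ht, tiltedMean_dirac hc (quant_spec hpos ht).1]

theorem monotoneOn_limitQuantile (ha : 0 < a) (hab : ∀ᵐ x ∂μ, x ∈ Set.Icc a b) :
    MonotoneOn (limitQuantile μ) (Set.Ioo 0 1) := by
  by_cases hne : ∀ c, μ ≠ Measure.dirac c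
  · exact (strictMonoOn_limitQuantile ha hab hne).monotoneOn
  · push Not at hne
    obtain ⟨c, rfl⟩ := hne
    have hc : 0 < c := by
      rw [ae_dirac_eq, eventually_pure] at hab
      exact ha.trans_le hab.1
    intro t ht t' ht' _
    rw [limitQuantile_dirac hc ht, limitQuantile_dirac hc ht']

end Quantile

/-- Convergence of the distribution functions at the continuity points implies weak convergence. -/
theorem weakConv_of_tendsto_Iic {σ : ℕ → Measure ℝ} {ν : Measure ℝ}
    (hσ : ∀ n, IsProbabilityMeasure (σ n)) [hν : IsProbabilityMeasure ν]
    (h : ∀ x, ν {x} = 0 →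
      Tendsto (fun n => (σ n).real (Set.Iic x)) atTop (𝓝 (ν.real (Set.Iic x)))) :
    WeakConv σ ν := by
  -- Half-open intervals whose endpoints are not atoms form a π-system. There are only countably
  -- many atoms, so such endpoints are dense and the intervals give neighbourhoods inside every open
  -- set.
  set S : Set (Set ℝ) := {s | ∃ a b, ν {a} = 0 ∧ ν {b} = 0 ∧ a ≤ b ∧ Set.Ioc a b = s} with hS
  have hIoc : ∀ (m : Measure ℝ) [IsProbabilityMeasure m] {a b : ℝ}, a ≤ b →
      m.real (Set.Ioc a b) = m.real (Set.Iic b) - m.real (Set.Iic a) := by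
    intro m _ a b hab
    rw [← measureReal_sdiff (Set.Iic_subset_Iic.2 hab) measurableSet_Iic]
    congr 1
    ext x
    simp [and_comm]
  have hcount : {x : ℝ | ν {x} = 0}ᶜ.Countable := by
    refine (Measure.countable_meas_level_set_pos (μ := ν) (measurable_id (α := ℝ))).mono ?_
    intro x hx
    exact pos_iff_ne_zero.2 hx
  have hdense : Dense {x : ℝ | ν {x} = 0} := by
    simpa using hcount.dense_compl ℝ
  have key := IsPiSystem.tendsto_probabilityMeasure_of_tendsto_of_mem (S := S) (l := atTop)
    (μ := fun n => (⟨σ n, hσ n⟩ : ProbabilityMeasure ℝ)) (ν := ⟨ν, hν⟩) ?_ ?_ ?_ ?_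
  · exact ProbabilityMeasure.tendsto_iff_forall_integral_tendsto.1 key
  · rintro _ ⟨a, b, ha, hb, hab, rfl⟩ _ ⟨a', b', ha', hb', hab', rfl⟩ hne
    rw [Set.Ioc_inter_Ioc] at hne ⊢
    refine ⟨a ⊔ a', b ⊓ b', ?_, ?_, ?_, rfl⟩
    · rcases max_choice a a' with h | h <;> rwa [h]
    · rcases min_choice b b' with h | h <;> rwa [h]
    · exact (Set.nonempty_Ioc.1 hne).le
  · rintro _ ⟨a, b, -, -, -, rfl⟩
    exact measurableSet_Ioc
  · intro u hu x hx
    obtain ⟨ε, hε, hball⟩ := Metric.isOpen_iff.1 hu x hx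
    obtain ⟨a, ha, ha1, ha2⟩ := hdense.exists_between (show x - ε < x by linarith)
    obtain ⟨b, hb, hb1, hb2⟩ := hdense.exists_between (show x < x + ε by linarith)
    refine ⟨Set.Ioc a b, ⟨a, b, ha, hb, (ha2.trans hb1).le, rfl⟩, Ioc_mem_nhds ha2 hb1, ?_⟩
    intro y hy
    refine hball ?_
    rw [Metric.mem_ball, Real.dist_eq, abs_lt]
    constructor <;> linarith [hy.1, hy.2]
  · rintro _ ⟨a, b, ha, hb, hab, rfl⟩
    have h1 := (h b hb).sub (h a ha)
    rw [← hIoc ν hab] at h1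
    have h2 : Tendsto (fun n => (σ n).real (Set.Ioc a b)) atTop (𝓝 (ν.real (Set.Ioc a b))) := by
      refine h1.congr fun n => ?_
      have := hσ n
      exact (hIoc (σ n) hab).symm
    exact NNReal.tendsto_coe.1 h2

/-- The law `Φ(μ)`, as the law of `1 / S_μ(t - 1)` for `t` uniform in `(0,1)`. -/
noncomputable def limitLaw (μ : Measure ℝ) : Measure ℝ :=
  (volume.restrict (Set.Ioo 0 1)).map (limitQuantile μ)

instance isProbabilityMeasure_restrict_Ioo :
    IsProbabilityMeasure (volume.restrict (Set.Ioo (0 : ℝ) 1)) :=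
  ⟨by simp⟩

/-! ### Existence and uniqueness of `Φ(μ)` -/

section LimitLaw

variable {μ : Measure ℝ} [IsProbabilityMeasure μ] {a b : ℝ}

theorem aemeasurable_limitQuantile (ha : 0 < a) (hab : ∀ᵐ x ∂μ, x ∈ Set.Icc a b) :
    AEMeasurable (limitQuantile μ) (volume.restrict (Set.Ioo 0 1)) :=
  aemeasurable_restrict_of_monotoneOn measurableSet_Ioo (monotoneOn_limitQuantile ha hab)

theorem isProbabilityMeasure_limitLaw (ha : 0 < a) (hab : ∀ᵐ x ∂μ, x ∈ Set.Icc a b) :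
    IsProbabilityMeasure (limitLaw μ) :=
  Measure.isProbabilityMeasure_map (aemeasurable_limitQuantile ha hab)

theorem limitLaw_apply (ha : 0 < a) (hab : ∀ᵐ x ∂μ, x ∈ Set.Icc a b) {s : Set ℝ}
    (hs : MeasurableSet s) :
    limitLaw μ s = volume (limitQuantile μ ⁻¹' s ∩ Set.Ioo 0 1) := by
  rw [limitLaw, Measure.map_apply_of_aemeasurable (aemeasurable_limitQuantile ha hab) hs,
    Measure.restrict_apply' measurableSet_Ioo]

theorem limitLaw_ae_mem_Icc (ha : 0 < a) (hab : ∀ᵐ x ∂μ, x ∈ Set.Icc a b) :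
    ∀ᵐ x ∂limitLaw μ, x ∈ Set.Icc a b := by
  refine (ae_map_iff (aemeasurable_limitQuantile ha hab) measurableSet_Icc).2 ?_
  rw [ae_restrict_iff' measurableSet_Ioo]
  exact Eventually.of_forall fun t ht => limitQuantile_mem_Icc ha hab ht

/-- Together with `le_limitLaw_Iic`, this makes `limitQuantile μ` a generalized inverse of the
distribution function. Both follow by comparing the preimage of a half-line with `(0,t)` through
monotonicity. -/
theorem limitLaw_Iic_le (ha : 0 < a) (hab : ∀ᵐ x ∂μ, x ∈ Set.Icc a b) {t x : ℝ}
    (ht : t ∈ Set.Ioo (0 : ℝ) 1) (hx : x < limitQuantile μ t) :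
    (limitLaw μ).real (Set.Iic x) ≤ t := by
  rw [Measure.real, limitLaw_apply ha hab measurableSet_Iic]
  refine ENNReal.toReal_le_of_le_ofReal ht.1.le ?_
  have h : limitQuantile μ ⁻¹' Set.Iic x ∩ Set.Ioo 0 1 ⊆ Set.Ioo 0 t := by
    rintro r ⟨hr, hr'⟩
    refine ⟨hr'.1, ?_⟩
    by_contra hlt
    exact absurd (monotoneOn_limitQuantile ha hab ht hr' (not_lt.1 hlt))
      (not_le.2 (lt_of_le_of_lt hr hx))
  simpa using measure_mono (μ := volume) h

theorem le_limitLaw_Iic (ha : 0 < a) (hab : ∀ᵐ x ∂μ, x ∈ Set.Icc a b) {t x : ℝ}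
    (ht : t ∈ Set.Ioo (0 : ℝ) 1) (hx : limitQuantile μ t ≤ x) :
    t ≤ (limitLaw μ).real (Set.Iic x) := by
  have := isProbabilityMeasure_limitLaw ha hab
  refine (ENNReal.ofReal_le_iff_le_toReal (measure_ne_top _ _)).1 ?_
  rw [limitLaw_apply ha hab measurableSet_Iic]
  have h : Set.Ioo 0 t ⊆ limitQuantile μ ⁻¹' Set.Iic x ∩ Set.Ioo 0 1 := by
    intro r hr
    have hr' : r ∈ Set.Ioo (0 : ℝ) 1 := ⟨hr.1, hr.2.trans ht.2⟩
    exact ⟨(monotoneOn_limitQuantile ha hab hr' ht hr.2.le).trans hx, hr'⟩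
  simpa using measure_mono (μ := volume) h

/-- At a continuity point strictly below the distribution function, the quantile function is
strictly smaller. -/
theorem limitQuantile_lt (ha : 0 < a) (hab : ∀ᵐ x ∂μ, x ∈ Set.Icc a b) {t x : ℝ}
    (ht : 0 < t) (hx : limitLaw μ {x} = 0) (htx : t < (limitLaw μ).real (Set.Iic x)) :
    limitQuantile μ t < x := by
  have := isProbabilityMeasure_limitLaw ha hab
  obtain ⟨t', h1, h2⟩ := exists_between htx
  have hle1 : (limitLaw μ).real (Set.Iic x) ≤ 1 := measureReal_le_one
  have ht1 : t ∈ Set.Ioo (0 : ℝ) 1 := ⟨ht, htx.trans_le hle1⟩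
  have ht1' : t' ∈ Set.Ioo (0 : ℝ) 1 := ⟨ht.trans h1, h2.trans_le hle1⟩
  have hg' : limitQuantile μ t' ≤ x := by
    by_contra hlt
    exact absurd (limitLaw_Iic_le ha hab ht1' (not_le.1 hlt)) (not_le.2 h2)
  have hgg := monotoneOn_limitQuantile ha hab ht1 ht1' h1.le
  -- Equality would make the quantile function constantly `x` on `(t,t')`, hence `x` an atom.
  refine lt_of_le_of_ne (hgg.trans hg') fun heq => ?_
  have hsub : Set.Ioo t t' ⊆ limitQuantile μ ⁻¹' {x} ∩ Set.Ioo 0 1 := by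
    intro r hr
    have hr' : r ∈ Set.Ioo (0 : ℝ) 1 := ⟨ht.trans hr.1, hr.2.trans ht1'.2⟩
    refine ⟨le_antisymm ?_ ?_, hr'⟩
    · exact (monotoneOn_limitQuantile ha hab hr' ht1' hr.2.le).trans hg'
    · exact heq ▸ monotoneOn_limitQuantile ha hab ht1 hr' hr.1.le
  rw [limitLaw_apply ha hab (measurableSet_singleton x)] at hx
  have h0 := measure_mono_null hsub hx
  simp only [Real.volume_Ioo, ENNReal.ofReal_eq_zero] at h0
  linarith

theorem limitLaw_dirac {c : ℝ} (hc : 0 < c) :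
    limitLaw (Measure.dirac c) = Measure.dirac c := by
  have h : limitQuantile (Measure.dirac c) =ᵐ[volume.restrict (Set.Ioo 0 1)] fun _ => c := by
    rw [EventuallyEq, ae_restrict_iff' measurableSet_Ioo]
    exact Eventually.of_forall fun t ht => limitQuantile_dirac hc ht
  rw [limitLaw, Measure.map_congr h, Measure.map_const, measure_univ, one_smul]

theorem measure_singleton_zero_of_ae {ρ : Measure ℝ} (hpos : ∀ᵐ x ∂ρ, 0 < x) : ρ {0} = 0 := by
  refine measure_mono_null (fun x hx => ?_) (ae_iff.1 hpos)
  rw [Set.mem_singleton_iff.1 hx]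
  exact lt_irrefl 0

theorem measure_Iio_zero_of_ae {ρ : Measure ℝ} (hpos : ∀ᵐ x ∂ρ, 0 < x) : ρ (Set.Iio 0) = 0 :=
  measure_mono_null (fun _ hx => not_lt.2 (le_of_lt hx)) (ae_iff.1 hpos)

theorem isLimitLaw_limitLaw (ha : 0 < a) (hab : ∀ᵐ x ∂μ, x ∈ Set.Icc a b) :
    IsLimitLaw μ (limitLaw μ) := by
  have hpos : ∀ᵐ x ∂μ, 0 < x := hab.mono fun x hx => ha.trans_le hx.1
  have hposL : ∀ᵐ x ∂limitLaw μ, 0 < x :=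
    (limitLaw_ae_mem_Icc ha hab).mono fun x hx => ha.trans_le hx.1
  have h0 := measure_singleton_zero_of_ae hpos
  refine ⟨isProbabilityMeasure_limitLaw ha hab, measure_Iio_zero_of_ae hposL, ?_, ?_, ?_⟩
  · rw [h0, measure_singleton_zero_of_ae hposL]
  · rintro c rfl
    refine limitLaw_dirac ?_
    rw [ae_dirac_eq, eventually_pure] at hpos
    exact hpos
  · intro hne t ht
    rw [Measure.real, h0, ENNReal.toReal_zero] at ht
    have hmono := strictMonoOn_limitQuantile ha hab hne
    change (limitLaw μ).real (Set.Icc 0 (limitQuantile μ t)) = t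
    have hset : limitQuantile μ ⁻¹' (Set.Icc 0 (limitQuantile μ t)) ∩ Set.Ioo 0 1 =
        Set.Ioc 0 t := by
      ext r
      constructor
      · rintro ⟨hr, hr'⟩
        exact ⟨hr'.1, (hmono.le_iff_le hr' ht).1 hr.2⟩
      · intro hr
        have hr' : r ∈ Set.Ioo (0 : ℝ) 1 := ⟨hr.1, hr.2.trans_lt ht.2⟩
        exact ⟨⟨ha.le.trans (limitQuantile_mem_Icc ha hab hr').1, (hmono.le_iff_le hr' ht).2 hr.2⟩,
          hr'⟩
    rw [Measure.real, limitLaw_apply ha hab measurableSet_Icc, hset]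
    simp [ht.1.le]

/-- The defining condition fixes the distribution function of `Φ` at every quantile; monotonicity
squeezes it elsewhere, also across jumps of `limitQuantile μ`. -/
theorem eq_limitLaw_of_isLimitLaw (ha : 0 < a) (hab : ∀ᵐ x ∂μ, x ∈ Set.Icc a b)
    {Φ : Measure ℝ} (hΦ : IsLimitLaw μ Φ) : Φ = limitLaw μ := by
  have hpos : ∀ᵐ x ∂μ, 0 < x := hab.mono fun x hx => ha.trans_le hx.1
  have hL := isLimitLaw_limitLaw ha hab
  by_cases hne : ∀ c, μ ≠ Measure.dirac c
  · have := hΦ.prob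
    have := hL.prob
    have hΦt : ∀ t ∈ Set.Ioo (0 : ℝ) 1, Φ.real (Set.Iic (limitQuantile μ t)) = t := by
      intro t ht
      have h1 := hΦ.cdf hne t (by
        rwa [Measure.real, measure_singleton_zero_of_ae hpos, ENNReal.toReal_zero])
      refine Eq.trans (measureReal_congr ?_) h1
      have h2 : ∀ᵐ x ∂Φ, 0 ≤ x := by
        rw [ae_iff]
        simpa [Set.Iio] using hΦ.nonneg
      filter_upwards [h2] with x hx
      exact propext ⟨fun h => ⟨hx, h⟩, fun h => h.2⟩
    have hle1 : ∀ x, (limitLaw μ).real (Set.Iic x) ≤ 1 := fun x => measureReal_le_one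
    have hle : ∀ x, Φ.real (Set.Iic x) = (limitLaw μ).real (Set.Iic x) := by
      intro x
      refine le_antisymm (le_of_forall_gt_imp_ge_of_dense fun t ht => ?_)
        (le_of_forall_lt_imp_le_of_dense fun t ht => ?_)
      · rcases lt_or_ge t 1 with h1 | h1
        · have ht' : t ∈ Set.Ioo (0 : ℝ) 1 := ⟨measureReal_nonneg.trans_lt ht, h1⟩
          have hx : x < limitQuantile μ t := by
            by_contra hlt
            exact absurd (le_limitLaw_Iic ha hab ht' (not_lt.1 hlt)) (not_le.2 ht)
          exact hΦt t ht' ▸ measureReal_mono (Set.Iic_subset_Iic.2 hx.le)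
        · exact measureReal_le_one.trans h1
      · rcases lt_or_ge 0 t with h1 | h1
        · have ht' : t ∈ Set.Ioo (0 : ℝ) 1 := ⟨h1, ht.trans_le (hle1 x)⟩
          have hx : limitQuantile μ t ≤ x := by
            by_contra hlt
            exact absurd (limitLaw_Iic_le ha hab ht' (not_le.1 hlt)) (not_le.2 ht)
          exact (hΦt t ht').symm.le.trans (measureReal_mono (Set.Iic_subset_Iic.2 hx))
        · exact h1.trans measureReal_nonneg
    refine Measure.ext_of_Iic _ _ fun x => ?_
    exact (measureReal_eq_measureReal_iff).1 (hle x)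
  · push Not at hne
    obtain ⟨c, hc⟩ := hne
    rw [hΦ.dirac c hc, hL.dirac c hc]

end LimitLaw

/-! ### Law of large numbers for free multiplicative powers -/

section Powers

variable {μ : Measure ℝ} [IsProbabilityMeasure μ] {a b : ℝ} {ρ : ℕ → Measure ℝ}

/-- No power acquires an atom at the origin, so all S-transforms live on the full interval `(-1,0)`
and multiply there. -/
theorem IsFreeMulPowers.spec (hpos : ∀ᵐ x ∂μ, 0 < x) (h : IsFreeMulPowers μ ρ) {n : ℕ}
    (hn : 1 ≤ n) : IsProbabilityMeasure (ρ n) ∧ (∀ᵐ x ∂ρ n, 0 < x) ∧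
      ∀ z ∈ Set.Ioo (-1 : ℝ) 0, sTransform (ρ n) z = sTransform μ z ^ n := by
  have h0 : μ.real {0} = 0 := by
    rw [Measure.real, measure_singleton_zero_of_ae hpos, ENNReal.toReal_zero]
  induction n, hn using Nat.le_induction with
  | base =>
    rw [h.1]
    exact ⟨inferInstance, hpos, fun z _ => (pow_one _).symm⟩
  | succ n hn ih =>
    obtain ⟨h1, h2, h3⟩ := ih
    have hc := h.2 n hn
    have hn0 : (ρ n).real {0} = 0 := by
      rw [Measure.real, measure_singleton_zero_of_ae h2, ENNReal.toReal_zero]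
    have := hc.prob
    refine ⟨hc.prob, ae_pos_of_measure hc.nonneg ?_, fun z hz => ?_⟩
    · have := hc.atom
      rw [h0, hn0, max_self] at this
      exact (measureReal_eq_zero_iff).1 this
    · rw [hc.sTransform_mul z (by rwa [h0, hn0, max_self, zero_sub]), h3 z hz, pow_succ]

theorem quant_eq_of_powers (hpos : ∀ᵐ x ∂μ, 0 < x) (h : IsFreeMulPowers μ ρ) {n : ℕ}
    (hn : 1 ≤ n) {t : ℝ} (ht : t ∈ Set.Ioo (0 : ℝ) 1) :
    quant (ρ n) t = (1 - t) / t / limitQuantile μ t ^ n := by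
  have h1 := (h.spec hpos hn).2.2 (t - 1) ⟨by linarith [ht.1], by linarith [ht.2]⟩
  rw [sTransform_sub_one] at h1
  have := ht.1
  have := sub_pos.2 ht.2
  have hS := sTransform_pos hpos ht
  rw [limitQuantile, div_pow, one_pow, div_div_eq_mul_div, div_one, ← h1]
  field_simp

theorem map_root_Iic {σ : Measure ℝ} (hpos : ∀ᵐ x ∂σ, 0 < x) {n : ℕ} (hn : n ≠ 0) {x : ℝ}
    (hx : 0 ≤ x) : (σ.map fun y : ℝ => y ^ (1 / (n : ℝ))).real (Set.Iic x) =
      σ.real (Set.Iic (x ^ n)) := by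
  rw [map_measureReal_apply (by fun_prop) measurableSet_Iic]
  refine measureReal_congr ?_
  filter_upwards [hpos] with y hy
  refine propext ?_
  change y ^ (1 / (n : ℝ)) ≤ x ↔ y ≤ x ^ n
  rw [one_div, Real.rpow_inv_le_iff_of_pos hy.le hx (by positivity), Real.rpow_natCast]

/-- The kernel decreases in `x`, so on `(-∞,y]` it is at least its value at `y`. With
`stieltjes_le_Iic_add` this is a Markov-type comparison of `stieltjes σ` with the distribution
function. -/
theorem stieltjes_ge_mul_Iic {σ : Measure ℝ} [IsProbabilityMeasure σ] (hpos : ∀ᵐ x ∂σ, 0 < x)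
    {s y : ℝ} (hs : 0 ≤ s) :
    σ.real (Set.Iic y) * (1 / (1 + s * y)) ≤ stieltjes σ s := by
  have h1 : ∫ x, (Set.Iic y).indicator (fun _ => 1 / (1 + s * y)) x ∂σ =
      σ.real (Set.Iic y) * (1 / (1 + s * y)) := by
    rw [integral_indicator_const _ measurableSet_Iic, smul_eq_mul]
  rw [← h1, stieltjes]
  refine integral_mono_ae ((integrable_const _).indicator measurableSet_Iic)
    (integrable_stieltjes_kernel hpos hs) ?_
  filter_upwards [hpos] with x hx
  by_cases h : x ∈ Set.Iic y
  · rw [Set.indicator_of_mem h]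
    have : x ≤ y := h
    gcongr
  · rw [Set.indicator_of_notMem h]
    positivity

theorem stieltjes_le_Iic_add {σ : Measure ℝ} [IsProbabilityMeasure σ] (hpos : ∀ᵐ x ∂σ, 0 < x)
    {s y : ℝ} (hs : 0 ≤ s) (hy : 0 ≤ y) :
    stieltjes σ s ≤ σ.real (Set.Iic y) + 1 / (1 + s * y) := by
  have hind : Integrable ((Set.Iic y).indicator (fun _ => (1 : ℝ))) σ :=
    (integrable_const _).indicator measurableSet_Iic
  have h1 : ∫ x, ((Set.Iic y).indicator (fun _ => (1 : ℝ)) x + 1 / (1 + s * y)) ∂σ =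
      σ.real (Set.Iic y) + 1 / (1 + s * y) := by
    rw [integral_add hind (integrable_const _), integral_indicator_const _ measurableSet_Iic]
    simp
  rw [← h1, stieltjes]
  refine integral_mono_ae (integrable_stieltjes_kernel hpos hs)
    (hind.add (integrable_const _)) ?_
  filter_upwards [hpos] with x hx
  have h0 : 0 ≤ 1 / (1 + s * y) := by positivity
  by_cases h : x ∈ Set.Iic y
  · simp only [Set.indicator_of_mem h]
    have := (le_abs_self _).trans (stieltjes_kernel_bound hs hx)
    linarith
  · simp only [Set.indicator_of_notMem h, zero_add]
    have : y ≤ x := (not_le.1 h).le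
    gcongr

/-- At `s = quant (ρ n) t` the transform equals `t`, while `s x^n = (1-t)/t · (x / limitQuantile μ
t)^n` tends to 0. The kernel is thus nearly 1 on `(0, x^n]`, whose mass cannot much exceed `t`. -/
theorem eventually_Iic_lt (ha : 0 < a) (hab : ∀ᵐ x ∂μ, x ∈ Set.Icc a b)
    (h : IsFreeMulPowers μ ρ) {t x c : ℝ} (ht : t ∈ Set.Ioo (0 : ℝ) 1) (hx0 : 0 ≤ x)
    (hx : x < limitQuantile μ t) (hc : t < c) :
    ∀ᶠ n : ℕ in atTop, (ρ n).real (Set.Iic (x ^ n)) < c := by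
  have hpos : ∀ᵐ x ∂μ, 0 < x := hab.mono fun x hx => ha.trans_le hx.1
  have hg := hx0.trans_lt hx
  have hlim : Tendsto (fun n : ℕ => t * (1 + (1 - t) / t * (x / limitQuantile μ t) ^ n)) atTop
      (𝓝 (t * (1 + (1 - t) / t * 0))) :=
    (((tendsto_pow_atTop_nhds_zero_of_lt_one (div_nonneg hx0 hg.le)
      ((div_lt_one hg).2 hx)).const_mul _).const_add _).const_mul _
  rw [mul_zero, add_zero, mul_one] at hlim
  filter_upwards [hlim.eventually (gt_mem_nhds hc), eventually_ge_atTop 1] with n hn hn1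
  obtain ⟨hp, hρ, -⟩ := h.spec hpos hn1
  obtain ⟨hq, hq'⟩ := quant_spec hρ ht
  have h1 := stieltjes_ge_mul_Iic (y := x ^ n) hρ hq.le
  rw [hq', mul_one_div, div_le_iff₀ (by positivity), quant_eq_of_powers hpos h hn1 ht] at h1
  refine h1.trans_lt (lt_of_eq_of_lt ?_ hn)
  rw [div_pow]
  ring

/-- Here the same quantity `s x^n` tends to infinity, so the part beyond `x^n` contributes almost
nothing to `t`. -/
theorem eventually_lt_Iic (ha : 0 < a) (hab : ∀ᵐ x ∂μ, x ∈ Set.Icc a b)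
    (h : IsFreeMulPowers μ ρ) {t x c : ℝ} (ht : t ∈ Set.Ioo (0 : ℝ) 1)
    (hx : limitQuantile μ t < x) (hc : c < t) :
    ∀ᶠ n : ℕ in atTop, c < (ρ n).real (Set.Iic (x ^ n)) := by
  have hpos : ∀ᵐ x ∂μ, 0 < x := hab.mono fun x hx => ha.trans_le hx.1
  have hg : 0 < limitQuantile μ t := ha.trans_le (limitQuantile_mem_Icc ha hab ht).1
  have hx0 := hg.trans hx
  have hct : 0 < (1 - t) / t := div_pos (sub_pos.2 ht.2) ht.1
  have hlim : Tendsto (fun n : ℕ => t - 1 / (1 + (1 - t) / t * (x / limitQuantile μ t) ^ n)) atTop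
      (𝓝 (t - 0)) :=
    (tendsto_const_nhds.div_atTop (tendsto_atTop_add_const_left _ _
      ((tendsto_pow_atTop_atTop_of_one_lt ((one_lt_div hg).2 hx)).const_mul_atTop hct))).const_sub _
  rw [sub_zero] at hlim
  filter_upwards [hlim.eventually (lt_mem_nhds hc), eventually_ge_atTop 1] with n hn hn1
  obtain ⟨hp, hρ, -⟩ := h.spec hpos hn1
  obtain ⟨hq, hq'⟩ := quant_spec hρ ht
  have h1 := stieltjes_le_Iic_add hρ hq.le (pow_nonneg hx0.le n)
  rw [hq', quant_eq_of_powers hpos h hn1 ht] at h1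
  have e : (1 - t) / t / limitQuantile μ t ^ n * x ^ n =
      (1 - t) / t * (x / limitQuantile μ t) ^ n := by
    rw [div_pow]
    ring
  rw [e] at h1
  linarith

/-- The law of large numbers for free multiplicative convolution. -/
theorem weakConv_map_root_powers (ha : 0 < a) (hab : ∀ᵐ x ∂μ, x ∈ Set.Icc a b)
    (h : IsFreeMulPowers μ ρ) :
    WeakConv (fun n => (ρ n).map (fun x : ℝ => x ^ (1 / (n : ℝ)))) (limitLaw μ) := by
  have hpos : ∀ᵐ x ∂μ, 0 < x := hab.mono fun x hx => ha.trans_le hx.1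
  have := isProbabilityMeasure_limitLaw ha hab
  have hprob : ∀ n : ℕ, IsProbabilityMeasure
      ((ρ (n + 1)).map (fun x : ℝ => x ^ (1 / ((n + 1 : ℕ) : ℝ)))) := fun n =>
    have := (h.spec hpos (Nat.le_add_left 1 n)).1
    Measure.isProbabilityMeasure_map (by fun_prop)
  -- `ρ 0` is unconstrained, so the sequence is shifted to begin at `ρ 1`.
  suffices hshift : WeakConv
      (fun n => (ρ (n + 1)).map (fun x : ℝ => x ^ (1 / ((n + 1 : ℕ) : ℝ)))) (limitLaw μ) from
    fun f => (tendsto_add_atTop_iff_nat 1).1 (hshift f)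
  refine weakConv_of_tendsto_Iic hprob fun x hx => ?_
  rcases lt_or_ge x a with hxa | hxa
  · have hzero : (limitLaw μ).real (Set.Iic x) = 0 := by
      refine (measureReal_eq_zero_iff).2 (measure_mono_null ?_ (limitLaw_ae_mem_Icc ha hab))
      exact fun y hy hy' => absurd hy'.1 (not_le.2 (lt_of_le_of_lt hy hxa))
    rw [hzero]
    rcases lt_or_ge x 0 with hx0 | hx0
    · refine tendsto_const_nhds.congr fun n => ?_
      rw [map_measureReal_apply (by fun_prop) measurableSet_Iic]
      symm
      refine (measureReal_eq_zero_iff (h := ?_)).2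
        (measure_mono_null ?_ (h.spec hpos (Nat.le_add_left 1 n)).2.1)
      · have := (h.spec hpos (Nat.le_add_left 1 n)).1
        exact measure_ne_top _ _
      · exact fun y hy hy' => absurd (Real.rpow_nonneg (le_of_lt hy') _)
          (not_le.2 (lt_of_le_of_lt hy hx0))
    · rw [tendsto_order]
      refine ⟨fun c hc => Eventually.of_forall fun n => hc.trans_le measureReal_nonneg,
        fun c hc => ?_⟩
      -- Since `x < a`, it lies below every quantile, so any `t` in `(0,1)` smaller than `c` will
      -- do.
      obtain ⟨t, ht0, ht1⟩ := exists_between (lt_min hc one_pos)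
      have ht : t ∈ Set.Ioo (0 : ℝ) 1 := ⟨ht0, ht1.trans_le (min_le_right _ _)⟩
      have hev := (tendsto_add_atTop_nat 1).eventually (eventually_Iic_lt ha hab h ht hx0
        (hxa.trans_le (limitQuantile_mem_Icc ha hab ht).1) (ht1.trans_le (min_le_left _ _)))
      filter_upwards [hev] with n hn
      rwa [map_root_Iic (h.spec hpos (Nat.le_add_left 1 n)).2.1 (Nat.succ_ne_zero n) hx0]
  · have hx0 := ha.le.trans hxa
    rw [tendsto_order]
    constructor
    · intro c hc
      rcases lt_or_ge c 0 with hc0 | hc0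
      · exact Eventually.of_forall fun n => hc0.trans_le measureReal_nonneg
      obtain ⟨t, ht0, ht1⟩ := exists_between hc
      have ht : t ∈ Set.Ioo (0 : ℝ) 1 := ⟨hc0.trans_lt ht0, ht1.trans_le measureReal_le_one⟩
      have hev := (tendsto_add_atTop_nat 1).eventually (eventually_lt_Iic ha hab h ht
        (limitQuantile_lt ha hab ht.1 hx ht1) ht0)
      filter_upwards [hev] with n hn
      rwa [map_root_Iic (h.spec hpos (Nat.le_add_left 1 n)).2.1 (Nat.succ_ne_zero n) hx0]
    · intro c hc
      rcases lt_or_ge 1 c with hc1 | hc1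
      · filter_upwards with n
        have := hprob n
        exact measureReal_le_one.trans_lt hc1
      obtain ⟨t, ht0, ht1⟩ := exists_between hc
      have ht : t ∈ Set.Ioo (0 : ℝ) 1 := ⟨measureReal_nonneg.trans_lt ht0, ht1.trans_le hc1⟩
      have hxt : x < limitQuantile μ t := by
        by_contra hlt
        exact absurd (le_limitLaw_Iic ha hab ht (not_lt.1 hlt)) (not_le.2 ht0)
      have hev := (tendsto_add_atTop_nat 1).eventually (eventually_Iic_lt ha hab h ht hx0 hxt ht1)
      filter_upwards [hev] with n hn
      rwa [map_root_Iic (h.spec hpos (Nat.le_add_left 1 n)).2.1 (Nat.succ_ne_zero n) hx0]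

end Powers

/-! ### The logarithmic integral of `Φ(μ)` -/

section LogIntegral

theorem volume_Ioc_inter_Ioo {c : ℝ} (h1 : c ≤ 1) :
    volume (Set.Ioc 0 c ∩ Set.Ioo (0 : ℝ) 1) = ENNReal.ofReal c := by
  refine le_antisymm ?_ ?_
  · simpa using measure_mono (μ := volume)
      (Set.inter_subset_left : Set.Ioc 0 c ∩ Set.Ioo (0 : ℝ) 1 ⊆ _)
  · have h : Set.Ioo 0 c ⊆ Set.Ioc 0 c ∩ Set.Ioo (0 : ℝ) 1 := fun x hx =>
      ⟨⟨hx.1, hx.2.le⟩, hx.1, hx.2.trans_le h1⟩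
    simpa using measure_mono (μ := volume) h

variable {μ : Measure ℝ} [IsProbabilityMeasure μ] {a b : ℝ}

theorem stieltjes_le_one (hpos : ∀ᵐ x ∂μ, 0 < x) {s : ℝ} (hs : 0 ≤ s) : stieltjes μ s ≤ 1 := by
  refine (integral_mono_ae (g := fun _ => 1) (integrable_stieltjes_kernel hpos hs)
    (integrable_const _) ?_).trans (by simp)
  filter_upwards [hpos] with x hx using (le_abs_self _).trans (stieltjes_kernel_bound hs hx)

theorem aemeasurable_quant (hpos : ∀ᵐ x ∂μ, 0 < x) :
    AEMeasurable (quant μ) (volume.restrict (Set.Ioo 0 1)) := by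
  refine aemeasurable_restrict_of_antitoneOn measurableSet_Ioo fun t ht t' ht' h => ?_
  rcases h.eq_or_lt with rfl | h
  · exact le_rfl
  · exact (quant_lt hpos ht.1 ht'.2 h).le

/-- If `V` is uniform on `(0,1)` and `X` has law `μ`, then `(1 - V) / (V X)` has the law of
`-ψ_μ⁻¹(V - 1)`. -/
theorem map_quant_eq (hpos : ∀ᵐ x ∂μ, 0 < x) :
    (volume.restrict (Set.Ioo 0 1)).map (quant μ) =
      ((volume.restrict (Set.Ioo 0 1)).prod μ).map
        (fun z : ℝ × ℝ => (1 - z.1) / z.1 / z.2) := by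
  have hmeas : Measurable fun z : ℝ × ℝ => (1 - z.1) / z.1 / z.2 := by fun_prop
  have := Measure.isProbabilityMeasure_map (aemeasurable_quant hpos)
  refine Measure.ext_of_Ici _ _ fun s => ?_
  -- Both laws are carried by the positive reals, so negative thresholds may be replaced by 0.
  set r := max s 0 with hr
  have hr0 : 0 ≤ r := le_max_right _ _
  have h1 : quant μ ⁻¹' Set.Ici s ∩ Set.Ioo 0 1 = Set.Ioc 0 (stieltjes μ r) ∩ Set.Ioo 0 1 := by
    ext t
    refine and_congr_left fun ht => ?_
    have hq := (quant_spec hpos ht).1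
    have h2 : s ≤ quant μ t ↔ r ≤ quant μ t := by
      rw [hr, max_le_iff]
      exact ⟨fun h => ⟨h, hq.le⟩, fun h => h.1⟩
    change s ≤ quant μ t ↔ _
    rw [h2, le_quant_iff hpos ht hr0]
    exact ⟨fun h => ⟨ht.1, h⟩, fun h => h.2⟩
  -- Integrate over `v` for fixed `x`: the condition `r ≤ (1-v)/(v x)` means `v ≤ 1/(1+rx)`, so the
  -- slice has length equal to the kernel of `stieltjes μ r`. On the left, `quant μ t ≥ r` means `t
  -- ≤ stieltjes μ r`.
  rw [Measure.map_apply_of_aemeasurable (aemeasurable_quant hpos) measurableSet_Ici,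
    Measure.restrict_apply' measurableSet_Ioo, h1, volume_Ioc_inter_Ioo (stieltjes_le_one hpos hr0),
    Measure.map_apply hmeas measurableSet_Ici,
    Measure.prod_apply_symm (hmeas measurableSet_Ici), stieltjes,
    ofReal_integral_eq_lintegral_ofReal (integrable_stieltjes_kernel hpos hr0)
      (hpos.mono fun x hx => by positivity)]
  refine lintegral_congr_ae ?_
  filter_upwards [hpos] with x hx
  have hle : 1 / (1 + r * x) ≤ 1 := (le_abs_self _).trans (stieltjes_kernel_bound hr0 hx)
  rw [Measure.restrict_apply' measurableSet_Ioo, ← volume_Ioc_inter_Ioo hle]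
  congr 1
  ext v
  refine and_congr_left fun hv => ?_
  have hv0 := hv.1
  have hv1 := sub_pos.2 hv.2
  change _ ↔ s ≤ (1 - v) / v / x
  have h2 : s ≤ (1 - v) / v / x ↔ r ≤ (1 - v) / v / x := by
    rw [hr, max_le_iff]
    exact ⟨fun h => ⟨h, by positivity⟩, fun h => h.1⟩
  rw [h2, div_div, le_div_iff₀ (by positivity), Set.mem_Ioc, le_div_iff₀ (by positivity)]
  constructor
  · rintro ⟨-, h⟩
    linarith
  · intro h
    exact ⟨hv0, by linarith⟩

theorem integrable_log_Ioo : Integrable Real.log (volume.restrict (Set.Ioo (0 : ℝ) 1)) := by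
  have h := (intervalIntegral.intervalIntegrable_log' (a := 0) (b := 1)).1
  exact h.mono_set Set.Ioo_subset_Ioc_self

theorem integrable_log_one_sub_Ioo :
    Integrable (fun v => Real.log (1 - v)) (volume.restrict (Set.Ioo (0 : ℝ) 1)) := by
  have h := ((intervalIntegral.intervalIntegrable_log' (a := 0) (b := 1)).comp_sub_left 1).symm.1
  simp only [sub_zero, sub_self] at h
  exact h.mono_set Set.Ioo_subset_Ioc_self

/-- The reflection `v ↦ 1 - v` exchanges the two logarithms. -/
theorem integral_log_one_sub_Ioo :
    ∫ v in Set.Ioo (0 : ℝ) 1, (Real.log (1 - v) - Real.log v) = 0 := by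
  rw [integral_sub integrable_log_one_sub_Ioo integrable_log_Ioo, ← integral_Ioc_eq_integral_Ioo,
    ← integral_Ioc_eq_integral_Ioo, ← intervalIntegral.integral_of_le zero_le_one,
    ← intervalIntegral.integral_of_le zero_le_one,
    intervalIntegral.integral_comp_sub_left (fun x => Real.log x)]
  simp

theorem integrable_log_of_mem_Icc (ha : 0 < a) {ρ : Measure ℝ} [IsFiniteMeasure ρ]
    (hab : ∀ᵐ x ∂ρ, x ∈ Set.Icc a b) : Integrable Real.log ρ := by
  refine Integrable.of_bound Real.measurable_log.aestronglyMeasurable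
    (max |Real.log a| |Real.log b|) ?_
  filter_upwards [hab] with x hx
  exact abs_le_max_abs_abs (Real.log_le_log ha hx.1) (Real.log_le_log (ha.trans_le hx.1) hx.2)

/-- The logarithmic integral of the limit law `Φ(μ)` is that of `μ`. -/
theorem integral_log_limitLaw (ha : 0 < a) (hab : ∀ᵐ x ∂μ, x ∈ Set.Icc a b) :
    ∫ x, Real.log x ∂limitLaw μ = ∫ x, Real.log x ∂μ := by
  have hpos : ∀ᵐ x ∂μ, 0 < x := hab.mono fun x hx => ha.trans_le hx.1
  have := isProbabilityMeasure_limitLaw ha hab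
  have hg := aemeasurable_limitQuantile ha hab
  have hint := integrable_log_of_mem_Icc ha (limitLaw_ae_mem_Icc ha hab)
  have hlog : ∀ m : Measure ℝ, AEStronglyMeasurable Real.log m := fun m =>
    Real.measurable_log.aestronglyMeasurable
  have hh : Integrable (fun v => Real.log (1 - v) - Real.log v)
      (volume.restrict (Set.Ioo (0 : ℝ) 1)) := integrable_log_one_sub_Ioo.sub integrable_log_Ioo
  have hgint : Integrable (fun t => Real.log (limitQuantile μ t))
      (volume.restrict (Set.Ioo (0 : ℝ) 1)) := (integrable_map_measure (hlog _) hg).1 hint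
  -- Pointwise `log (quant μ t) = log ((1-t)/t) - log (limitQuantile μ t)`, and the first term has
  -- integral zero.
  have e1 : ∫ x, Real.log x ∂(volume.restrict (Set.Ioo 0 1)).map (quant μ) =
      -∫ x, Real.log x ∂limitLaw μ := by
    rw [integral_map (aemeasurable_quant hpos) (hlog _), limitLaw, integral_map hg (hlog _),
      ← zero_sub]
    refine Eq.trans ?_ ((integral_sub hh hgint).trans (by rw [integral_log_one_sub_Ioo]))
    refine setIntegral_congr_fun measurableSet_Ioo fun t ht => ?_
    have h0 := ht.1
    have h1 := sub_pos.2 ht.2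
    have hq := (quant_spec hpos ht).1
    rw [limitQuantile, sTransform_sub_one, one_div, Real.log_inv,
      Real.log_mul (div_pos h0 h1).ne' hq.ne', Real.log_div h0.ne' h1.ne']
    ring
  have hμint := integrable_log_of_mem_Icc ha hab
  -- The product representation of the law of `quant μ` splits the logarithm again, now with `log
  -- X`, `X` distributed as `μ`, in place of the quantile.
  have e2 : ∫ x, Real.log x ∂(volume.restrict (Set.Ioo 0 1)).map (quant μ) =
      -∫ x, Real.log x ∂μ := by
    have hae : ∀ᵐ z ∂(volume.restrict (Set.Ioo (0 : ℝ) 1)).prod μ,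
        Real.log ((1 - z.1) / z.1 / z.2) =
          (Real.log (1 - z.1) - Real.log z.1) - Real.log z.2 := by
      have hf : ∀ᵐ z ∂(volume.restrict (Set.Ioo (0 : ℝ) 1)).prod μ, z.1 ∈ Set.Ioo (0 : ℝ) 1 :=
        Measure.quasiMeasurePreserving_fst.ae (ae_restrict_mem measurableSet_Ioo)
      have hs : ∀ᵐ z ∂(volume.restrict (Set.Ioo (0 : ℝ) 1)).prod μ, 0 < z.2 :=
        Measure.quasiMeasurePreserving_snd.ae hpos
      filter_upwards [hf, hs] with z hz1 hz2
      have h1 := sub_pos.2 hz1.2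
      rw [Real.log_div (div_pos h1 hz1.1).ne' hz2.ne', Real.log_div h1.ne' hz1.1.ne']
    rw [map_quant_eq hpos, integral_map (by fun_prop) (hlog _), integral_congr_ae hae,
      integral_sub (hh.comp_fst μ) (hμint.comp_snd _),
      integral_fun_fst (fun v => Real.log (1 - v) - Real.log v), integral_fun_snd,
      integral_log_one_sub_Ioo]
    simp
  linarith

end LogIntegral

/-! ### Empirical averages; arithmetic, harmonic and geometric means -/

section Empirical

theorem integrable_sum_dirac (s : Multiset ℝ) (f : ℝ → ℝ) :
    Integrable f (s.map fun x => Measure.dirac x).sum ∧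
      ∫ x, f x ∂(s.map fun x => Measure.dirac x).sum = (s.map f).sum := by
  induction s using Multiset.induction_on with
  | empty => simp
  | cons a s ih =>
    have ha : Integrable f (Measure.dirac a) := integrable_dirac (by simp)
    rw [Multiset.map_cons, Multiset.sum_cons, Multiset.map_cons, Multiset.sum_cons]
    exact ⟨ha.add_measure ih.1, by rw [integral_add_measure ha ih.1, ih.2, integral_dirac]⟩

theorem integral_empirical (s : Multiset ℝ) (f : ℝ → ℝ) :
    ∫ x, f x ∂empirical s = (s.card : ℝ)⁻¹ * (s.map f).sum := by
  rw [empirical, integral_smul_measure, (integrable_sum_dirac s f).2, smul_eq_mul]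
  simp

theorem notMem_of_empirical_eq_zero {s : Multiset ℝ} {A : Set ℝ} (h : empirical s A = 0) {x : ℝ}
    (hx : x ∈ s) : x ∉ A := by
  rw [empirical, Measure.smul_apply, smul_eq_mul, mul_eq_zero] at h
  have h1 := h.resolve_left (ENNReal.inv_ne_zero.2 (ENNReal.natCast_ne_top _))
  obtain ⟨t, rfl⟩ := Multiset.exists_cons_of_mem hx
  rw [Multiset.map_cons, Multiset.sum_cons, Measure.add_apply, add_eq_zero] at h1
  intro hxA
  simp [hxA] at h1

theorem tendsto_average {s : ℕ → Multiset ℝ} {μ : Measure ℝ}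
    (hconv : WeakConv (fun d => empirical (s d)) μ) {a b : ℝ} (hle : a ≤ b)
    (hs : ∀ d ≥ 1, ∀ x ∈ s d, x ∈ Set.Icc a b) (hμ : ∀ᵐ x ∂μ, x ∈ Set.Icc a b) {f : ℝ → ℝ}
    (hf : ContinuousOn f (Set.Icc a b)) :
    Tendsto (fun d => ((s d).card : ℝ)⁻¹ * ((s d).map f).sum) atTop (𝓝 (∫ x, f x ∂μ)) := by
  -- Composing with the projection onto `[a,b]` extends `f` to a bounded continuous function without
  -- changing any of the integrals.
  set F : ℝ →ᵇ ℝ := (BoundedContinuousFunction.mkOfCompact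
    ⟨(Set.Icc a b).domRestrict f, hf.domRestrict⟩).compContinuous
      ⟨Set.projIcc a b hle, continuous_projIcc⟩ with hF
  have hFf : ∀ x ∈ Set.Icc a b, F x = f x := by
    intro x hx
    change f (Set.projIcc a b hle x) = f x
    rw [Set.projIcc_of_mem hle hx]
  have h := hconv F
  rw [integral_congr_ae (hμ.mono hFf)] at h
  refine h.congr' ?_
  filter_upwards [eventually_ge_atTop 1] with d hd
  rw [integral_empirical, Multiset.map_congr rfl fun x hx => hFf x (hs d hd x hx)]

theorem limitRoot_one (s : Multiset ℝ) :
    limitRoot s 1 = (s.card : ℝ)⁻¹ * (s.map fun x => x).sum := by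
  rw [limitRoot, normEsymm_zero_right, normEsymm, div_one, Nat.choose_one_right, Multiset.esymm,
    Multiset.powersetCard_one, Multiset.map_map]
  simp [div_eq_inv_mul]

/-- Each product of all but one element is the full product divided by the omitted one. -/
theorem esymm_pred_card {s : Multiset ℝ} (hs : ∀ x ∈ s, x ≠ 0) {k : ℕ} (hk : s.card = k + 1) :
    s.esymm k = s.prod * (s.map fun x => x⁻¹).sum := by
  induction s using Multiset.induction_on generalizing k with
  | empty => simp at hk
  | cons a s ih =>
    have ha := hs a (Multiset.mem_cons_self a s)
    rw [Multiset.card_cons, Nat.add_right_cancel_iff] at hk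
    rw [Multiset.map_cons, Multiset.sum_cons, Multiset.prod_cons]
    cases k with
    | zero =>
      rw [Multiset.card_eq_zero.1 hk, esymm_zero_right]
      simp [ha]
    | succ k =>
      rw [esymm_cons_succ, ih (fun x hx => hs x (Multiset.mem_cons_of_mem hx)) hk, ← hk,
        esymm_card]
      field_simp

theorem limitRoot_card {s : Multiset ℝ} (hs : ∀ x ∈ s, 0 < x) (hcard : 1 ≤ s.card) :
    limitRoot s s.card = ((s.card : ℝ)⁻¹ * (s.map fun x => x⁻¹).sum)⁻¹ := by
  obtain ⟨k, hk⟩ : ∃ k, s.card = k + 1 := ⟨s.card - 1, by omega⟩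
  have hprod : 0 < s.prod := Multiset.prod_pos hs
  rw [limitRoot, normEsymm, normEsymm, esymm_card, hk, Nat.add_sub_cancel,
    esymm_pred_card (fun x hx => (hs x hx).ne') hk, Nat.choose_self,
    Nat.choose_succ_self_right, Nat.cast_one]
  field_simp

/-- The product of the ratios telescopes, starting from `ẽ_0 = 1`. At `n = s.card` it is the product
of all the elements. -/
theorem sum_log_limitRoot {s : Multiset ℝ} (hs : ∀ x ∈ s, 0 < x) {n : ℕ} (hn : n ≤ s.card) :
    ∑ i ∈ Finset.Icc 1 n, Real.log (limitRoot s i) = Real.log (normEsymm s n) := by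
  have hpos : ∀ k ≤ s.card, 0 < normEsymm s k := by
    intro k hk
    rw [normEsymm_pos_iff fun x hx => (hs x hx).le, Multiset.filter_eq_self.2 hs]
    exact hk
  induction n with
  | zero => simp [normEsymm_zero_right]
  | succ n ih =>
    rw [Finset.sum_Icc_succ_top (by omega), ih (by omega), limitRoot_succ,
      Real.log_div (hpos _ hn).ne' (hpos _ (by omega)).ne']
    ring

theorem integral_log_empirical_limitRoots {s : Multiset ℝ} (hs : ∀ x ∈ s, 0 < x) :
    ∫ t, Real.log t ∂empirical (limitRoots s) = (s.card : ℝ)⁻¹ * (s.map Real.log).sum := by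
  have hcard : (limitRoots s).card = s.card := by simp [limitRoots]
  rw [integral_empirical, hcard, ← Real.log_multiset_prod fun x hx => (hs x hx).ne', limitRoots, Multiset.map_map]
  congr 1
  refine (sum_log_limitRoot hs le_rfl).trans ?_
  rw [normEsymm, esymm_card, Nat.choose_self, Nat.cast_one, div_one]

end Empirical

end FiniteFree

/-! ### The proposition -/

theorem proposition4p2
    (p : ℕ → ℝ[X])
    (hmonic : ∀ d ≥ 1, (p d).Monic)
    (hdeg : ∀ d ≥ 1, (p d).natDegree = d)
    (hsplits : ∀ d ≥ 1, (p d).Splits)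
    (hnonneg : ∀ d ≥ 1, ∀ x ∈ (p d).roots, 0 ≤ x)
    (μ : Measure ℝ) [IsProbabilityMeasure μ]
    (K : Set ℝ) (hK : IsCompact K) (hK0 : K ⊆ Set.Ici 0)
    (hμK : μ Kᶜ = 0)
    (hμdK : ∀ d ≥ 1, FiniteFree.empirical (p d).roots Kᶜ = 0)
    (hconv : FiniteFree.WeakConv (fun d => FiniteFree.empirical (p d).roots) μ) :
    -- the numbers `R_i(Λ_d)` are the limit roots
    (∀ d ≥ 1, ∀ i ∈ Finset.Icc 1 d,
      Tendsto
        (fun n : ℕ =>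
          (FiniteFree.nthRoot (FiniteFree.mulConvPow d (p d) n) i) ^ (1 / (n : ℝ)))
        atTop (𝓝 (FiniteFree.limitRoot (p d).roots i))) ∧
    Tendsto (fun d => FiniteFree.limitRoot (p d).roots 1) atTop (𝓝 (∫ t, t ∂μ)) ∧
    (0 ∉ K →
      Tendsto (fun d => FiniteFree.limitRoot (p d).roots d) atTop (𝓝 (∫ t, t⁻¹ ∂μ)⁻¹) ∧
      -- the law `Φ(μ)` exists, is unique, and is the limit of `(μ^{⊠ n})^{1/n}`
      ∃ Φ : Measure ℝ, FiniteFree.IsLimitLaw μ Φ ∧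
        (∀ Φ' : Measure ℝ, FiniteFree.IsLimitLaw μ Φ' → Φ' = Φ) ∧
        (∀ ρ : ℕ → Measure ℝ, FiniteFree.IsFreeMulPowers μ ρ →
          FiniteFree.WeakConv
            (fun n => (ρ n).map (fun x : ℝ => x ^ (1 / (n : ℝ)))) Φ) ∧
        Integrable Real.log Φ ∧
        Tendsto
          (fun d => ∫ t, Real.log t ∂(FiniteFree.empirical (FiniteFree.limitRoots (p d).roots)))
          atTop (𝓝 (∫ t, Real.log t ∂Φ))) := by
  have hcard : ∀ d ≥ 1, (p d).roots.card = d := fun d hd =>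
    (splits_iff_card_roots.1 (hsplits d hd)).trans (hdeg d hd)
  have hroots : ∀ d ≥ 1, ∀ x ∈ (p d).roots, x ∈ K := fun d hd x hx => by
    simpa using FiniteFree.notMem_of_empirical_eq_zero (hμdK d hd) hx
  have hμae : ∀ᵐ x ∂μ, x ∈ K := hμK
  obtain ⟨x₀, hx₀⟩ := hμae.exists
  obtain ⟨b, hb⟩ := hK.bddAbove
  refine ⟨fun d hd i hi => ?_, ?_, fun h0K => ?_⟩
  · obtain ⟨k, rfl⟩ : ∃ k, i = k + 1 := ⟨i - 1, by have := (Finset.mem_Icc.1 hi).1; omega⟩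
    exact FiniteFree.tendsto_nthRoot_mulConvPow (hmonic d hd) (hdeg d hd) (hsplits d hd)
      (hnonneg d hd) (Finset.mem_Icc.1 hi).2
  · have hKb : ∀ x ∈ K, x ∈ Set.Icc 0 b := fun x hx => ⟨hK0 hx, hb hx⟩
    simp only [FiniteFree.limitRoot_one]
    exact FiniteFree.tendsto_average hconv ((hKb x₀ hx₀).1.trans (hKb x₀ hx₀).2)
      (fun d hd x hx => hKb x (hroots d hd x hx)) (hμae.mono hKb) continuousOn_id
  · obtain ⟨a, haK, hamin⟩ := hK.exists_isLeast ⟨x₀, hx₀⟩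
    have ha : 0 < a := lt_of_le_of_ne (hK0 haK) fun h => h0K (h ▸ haK)
    have hKab : ∀ x ∈ K, x ∈ Set.Icc a b := fun x hx => ⟨hamin hx, hb hx⟩
    have hab := hμae.mono hKab
    have hle : a ≤ b := (hKab x₀ hx₀).1.trans (hKab x₀ hx₀).2
    have hpos : ∀ᵐ x ∂μ, 0 < x := hab.mono fun x hx => ha.trans_le hx.1
    have hrpos : ∀ d ≥ 1, ∀ x ∈ (p d).roots, 0 < x := fun d hd x hx =>
      ha.trans_le (hKab x (hroots d hd x hx)).1
    have hav : ∀ {f : ℝ → ℝ}, ContinuousOn f (Set.Icc a b) → _ := fun hf =>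
      FiniteFree.tendsto_average hconv hle (fun d hd x hx => hKab x (hroots d hd x hx)) hab hf
    have hinv : ContinuousOn (fun x : ℝ => x⁻¹) (Set.Icc a b) :=
      continuousOn_id.inv₀ fun x hx => (ha.trans_le hx.1).ne'
    have hinvint : Integrable (fun x : ℝ => x⁻¹) μ := by
      refine Integrable.of_bound (by fun_prop) a⁻¹ ?_
      filter_upwards [hab] with x hx
      rw [norm_inv, Real.norm_of_nonneg (ha.le.trans hx.1)]
      exact inv_anti₀ ha hx.1
    refine ⟨?_, FiniteFree.limitLaw μ, FiniteFree.isLimitLaw_limitLaw ha hab,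
      fun Φ' hΦ' => FiniteFree.eq_limitLaw_of_isLimitLaw ha hab hΦ',
      fun ρ hρ => FiniteFree.weakConv_map_root_powers ha hab hρ, ?_, ?_⟩
    · have hne : ∫ t, t⁻¹ ∂μ ≠ 0 :=
        (FiniteFree.integral_pos_of_ae_pos hinvint (hpos.mono fun x hx => inv_pos.2 hx)).ne'
      refine ((hav hinv).inv₀ hne).congr' ?_
      filter_upwards [eventually_ge_atTop 1] with d hd
      have h := FiniteFree.limitRoot_card (hrpos d hd) (by rw [hcard d hd]; exact hd)
      rw [← h, hcard d hd]
    · have := FiniteFree.isProbabilityMeasure_limitLaw ha hab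
      exact FiniteFree.integrable_log_of_mem_Icc ha (FiniteFree.limitLaw_ae_mem_Icc ha hab)
    -- Both sides reduce to log-integrals of the original measures, so only `log` on `[a,b]` against
    -- `μ_d → μ` remains.
    · rw [FiniteFree.integral_log_limitLaw ha hab]
      refine (hav (Real.continuousOn_log.mono fun x hx => (ha.trans_le hx.1).ne')).congr' ?_
      filter_upwards [eventually_ge_atTop 1] with d hd
      exact (FiniteFree.integral_log_empirical_limitRoots (hrpos d hd)).symm
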